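/- **Setting.** Let $A\subset\mathbb R$ be a bounded convex set of actions, $b:A\times\mathbb R\to\mathbb R$, $f:\mathbb R\times A\times\mathbb R\to\mathbb R$, and let $\mu_0$ be a probability measure on $\mathbb R$ with mean $0$ and $\int\xi^2\mu_0(d\xi)<\infty$. Put $I=[0,1]$ with Lebesgue measure. For $\alpha\in A$, $z\in\mathbb R$ set $$\mathcal J(\alpha,z)=\int f(b(\alpha,z)+\xi,\alpha,z)\,\mu_0(d\xi),\qquad \tilde{\mathcal J}(\alpha,\nu)=\int f(b(\alpha,z)+\xi,\alpha,z)\,\nu(d\xi,dz),$$ for $\nu\in\mathcal K$, the set of probability measures on $\mathbb R\times\mathbb R$ with first marginal $\mu_0$ and finite second moment. Assume that there are constants $c_\alpha,c_z\ge 0$, $c_0>0$, $\ell_c>0$, $\ell_J,\tilde\ell_J\ge 0$ with: 1. $|b(\alpha,z)-b(\alpha',z')|^2\le c_\alpha|\alpha-\alpha'|^2+c_z|z-z'|^2$ and $|b(\alpha,z)|\le c_0$ for all $\alpha,\alpha'\in A$, $z,z'\in\mathbb R$; 2. for every $\alpha\in A$ and $\nu\in\mathcal K$ the integral $\tilde{\mathcal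 J}(\alpha,\nu)$ converges absolutely, and $|\tilde{\mathcal J}(\alpha,\nu')-\tilde{\mathcal J}(\alpha,\nu)|\le\tilde\ell_J W_2(\nu,\nu')$ for all $\nu,\nu'\in\mathcal K$, where $W_2$ is the $2$-Wasserstein distance; 3. for every $z$, $\mathcal J(\cdot,z)$ is $C^1$ on $A$ and $\mathcal J(\epsilon\alpha+(1-\epsilon)\alpha',z)\le\epsilon\mathcal J(\alpha,z)+(1-\epsilon)\mathcal J(\alpha',z)-\frac{\ell_c}{2}\epsilon(1-\epsilon)|\alpha-\alpha'|^2$ for $\alpha,\alpha'\in A$, $\epsilon\in[0,1]$; and $|\partial_\alpha\mathcal J(\alpha,z')-\partial_\alpha\mathcal J(\alpha,z)|\le\ell_J|z'-z|$ for $\alpha\in A$, $z,z'\in\mathbb R$. A *graphon* is a symmetric Borel measurable function $w:I\times I\to\mathbb R$ with $\|w\|_2^2=\int_{I\times I}w^2<\infty$; $\mathbf W g=\int_I w(\cdot,y)g(y)\,dy$ is its operator on $L^2(I)$, with operator norm $\|\mathbf W\|$, and $d_\square(w,w')=\sup_{S,T}\bigl|\int_{S\times T}(w-w')\bigr|$ over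 Borel $S,T\subset I$. If $\sqrt{c_z}\|\mathbf W\|<1$, every $\boldsymbol\alpha\in L^2(I)$ with values in $A$ has a unique aggregate $\mathbf Z\boldsymbol\alpha=\mathbf z\in L^2(I)$ with $z_x=\int_I w(x,y)b(\alpha_y,z_y)\,dy$ for a.e. $x$; such an $\hat{\boldsymbol\alpha}$ is a *Nash equilibrium of the graphon game* if for a.e. $x\in I$ and all $\beta\in A$, $\mathcal J(\hat\alpha_x,[\mathbf Z\hat{\boldsymbol\alpha}]_x)\le\mathcal J(\beta,[\mathbf Z\hat{\boldsymbol\alpha}]_x)$. For $N\ge1$ let $W^N$ be a symmetric real $N\times N$ matrix, $\|W^N\|_F^2=\frac1{N^2}\sum_{i,j}(W^N_{i,j})^2$, and let $\xi_1,\dots,\xi_N$ be i.i.d. with law $\mu_0$. If $\sqrt{c_z}\|W^N\|_F<1$, the *$N$-player game* is defined: for every $\boldsymbol\alpha\in A^N$ there is a unique square-integrable random vector $\mathbf Z_N\boldsymbol\alpha=\mathbf z$ with $z_i=\frac1N\sum_j W^N_{i,j}(b(\alpha_j,z_j)+\xi_j)$ a.s. for all $i$, and player $i$ pays $J_i(\boldsymbol\alpha)=\tilde{\mathcal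 J}(\alpha_i,\mathcal L(\xi_i,[\mathbf Z_N\boldsymbol\alpha]_i))$. A profile $\boldsymbol\alpha\in A^N$ is an *$\epsilon$-Nash equilibrium* if $J_i(\boldsymbol\alpha)\le J_i([\beta;\boldsymbol\alpha_{-i}])+\epsilon$ for all $i$ and all $\beta\in A$, where $[\beta;\boldsymbol\alpha_{-i}]$ replaces $\alpha_i$ by $\beta$. **Theorem.** Suppose that $\max_i\frac1{N^2}\sum_j(W^N_{i,j})^2\le\tilde\zeta$ for all $N\ge1$, with $\tilde\zeta$ independent of $N$. Let $w^N$ be the step graphon equal to $W^N_{i,j}$ on $[\frac{i-1}N,\frac iN)\times[\frac{j-1}N,\frac jN)$, with operator $\mathbf W^N$, and let $w$ be a graphon with operator $\mathbf W$ such that $\sqrt{2c_z}\|w\|_2<1$, $\sqrt{c_z}\|\mathbf W\|<1$, $\sup_{x\in I}(\int_I w(x,y)^2dy)^{1/2}\le\zeta<\infty$, $\|w^N\|_2\to\|w\|_2$, $\|\mathbf W^N\|\to\|\mathbf W\|$, and $d_\square(w^N,w)\le\gamma_N$ with $N\gamma_N\to0$. Let $\hat{\boldsymbol\alpha}$ be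 a Nash equilibrium of the graphon game with graphon $w$, and let $[\mu^N(\hat{\boldsymbol\alpha})]_i=N\int_{(i-1)/N}^{i/N}\hat\alpha_x\,dx$. Then there is a sequence $\epsilon_N\to0$ such that, for every $N\ge 1$ with $\sqrt{c_z}\|W^N\|_F<1$ (which holds for all large $N$), the $N$-player game with matrix $W^N$ is well defined, $\mu^N(\hat{\boldsymbol\alpha})\in A^N$, and $\mu^N(\hat{\boldsymbol\alpha})$ is an $\epsilon_N$-Nash equilibrium of it. -/

import Mathlib

open MeasureTheory ProbabilityTheory Filter Topology
open scoped ENNReal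

namespace GraphonGame

noncomputable section

/-- The continuum of players `I = [0,1]`, with its Borel σ-field and Lebesgue measure `volume`. -/
abbrev I : Type := unitInterval

/-- The Lebesgue space `L²(I)` of classes of real square-integrable functions. -/
abbrev L2I : Type := Lp ℝ 2 (volume : Measure I)

/-! ### Costs -/

/-- `𝒥(α,z) = E[f(X_{α,z,ξ₀}, α, z)]`, with state `X_{α,z,ξ} = b(α,z) + ξ` and `ξ₀` of law `μ₀`. -/
def costJ (b : ℝ → ℝ → ℝ) (f : ℝ → ℝ → ℝ → ℝ) (μ₀ : Measure ℝ) (α z : ℝ) : ℝ :=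
  ∫ ξ, f (b α z + ξ) α z ∂μ₀

/-- `𝒥̃(α,ν) = ∫ f(X_{α,z,ξ}, α, z) ν(dξ,dz)`, for `ν` a joint law of (noise, aggregate). -/
def costJTilde (b : ℝ → ℝ → ℝ) (f : ℝ → ℝ → ℝ → ℝ) (α : ℝ) (ν : Measure (ℝ × ℝ)) : ℝ :=
  ∫ p, f (b α p.2 + p.1) α p.2 ∂ν

/-! ### The 2-Wasserstein distance on `ℝ × ℝ` -/

/-- `π` is a coupling of `ν` and `ν'`. -/
def IsCoupling (ν ν' : Measure (ℝ × ℝ)) (π : Measure ((ℝ × ℝ) × (ℝ × ℝ))) : Prop :=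
  π.map Prod.fst = ν ∧ π.map Prod.snd = ν'

/-- The 2-Wasserstein distance for the Euclidean distance on `ℝ × ℝ`; it is only used between
probability measures with finite second moments, where the infimum is finite. -/
def wasserstein2 (ν ν' : Measure (ℝ × ℝ)) : ℝ :=
  Real.sqrt (⨅ (π : Measure ((ℝ × ℝ) × (ℝ × ℝ))) (_ : IsCoupling ν ν' π),
    ∫⁻ q, ENNReal.ofReal ((q.1.1 - q.2.1) ^ 2 + (q.1.2 - q.2.2) ^ 2) ∂π).toReal

/-- Probability measures on `ℝ × ℝ` with first marginal `μ₀` and finite second moment. -/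
structure IsJointLaw (μ₀ : Measure ℝ) (ν : Measure (ℝ × ℝ)) : Prop where
  prob : IsProbabilityMeasure ν
  fst_marginal : ν.map Prod.fst = μ₀
  second_moment : Integrable (fun p : ℝ × ℝ => p.1 ^ 2 + p.2 ^ 2) ν

/-! ### Standing assumptions -/

/-- The noise distribution is a centered probability measure with finite second moment. -/
structure NoiseLaw (μ₀ : Measure ℝ) : Prop where
  prob : IsProbabilityMeasure μ₀
  second_moment : Integrable (fun x : ℝ => x ^ 2) μ₀
  centered : ∫ x, x ∂μ₀ = 0

/-- Joint Lipschitz continuity of `b` on `A × ℝ`. -/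
structure DriftLipschitz (A : Set ℝ) (b : ℝ → ℝ → ℝ) (cα cz : ℝ) : Prop where
  cα_nonneg : 0 ≤ cα
  cz_nonneg : 0 ≤ cz
  lipschitz : ∀ α ∈ A, ∀ α' ∈ A, ∀ z z' : ℝ,
    |b α z - b α' z'| ^ 2 ≤ cα * |α - α'| ^ 2 + cz * |z - z'| ^ 2

/-- Boundedness of `b` on `A × ℝ`. -/
structure DriftBounded (A : Set ℝ) (b : ℝ → ℝ → ℝ) (c₀ : ℝ) : Prop where
  pos : 0 < c₀
  bound : ∀ α ∈ A, ∀ z : ℝ, |b α z| ≤ c₀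

/-- `𝒥̃(α,·)` is a well-defined real number at each joint law and is Lipschitz for the
2-Wasserstein distance, uniformly in `α ∈ A`. -/
structure CostWassersteinLipschitz (A : Set ℝ) (b : ℝ → ℝ → ℝ) (f : ℝ → ℝ → ℝ → ℝ)
    (μ₀ : Measure ℝ) (ℓ : ℝ) : Prop where
  nonneg : 0 ≤ ℓ
  integrable : ∀ α ∈ A, ∀ ν, IsJointLaw μ₀ ν →
    Integrable (fun p : ℝ × ℝ => f (b α p.2 + p.1) α p.2) ν
  lipschitz : ∀ α ∈ A, ∀ ν ν', IsJointLaw μ₀ ν → IsJointLaw μ₀ ν' →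
    |costJTilde b f α ν' - costJTilde b f α ν| ≤ ℓ * wasserstein2 ν ν'

/-- `𝒥(·,z)` is continuously differentiable and strongly convex on `A`, uniformly in `z`, and
`∂_α 𝒥(α,·)` is Lipschitz, uniformly in `α ∈ A` (derivatives at endpoints are one-sided). -/
structure CostConvex (A : Set ℝ) (b : ℝ → ℝ → ℝ) (f : ℝ → ℝ → ℝ → ℝ)
    (μ₀ : Measure ℝ) (ℓc ℓJ : ℝ) : Prop where
  ℓc_pos : 0 < ℓc
  ℓJ_nonneg : 0 ≤ ℓJ
  contDiff : ∀ z : ℝ, ContDiffOn ℝ 1 (fun α => costJ b f μ₀ α z) A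
  strongConvex : ∀ z : ℝ, StrongConvexOn A ℓc (fun α => costJ b f μ₀ α z)
  deriv_lipschitz : ∀ α ∈ A, ∀ z z' : ℝ,
    |derivWithin (fun a => costJ b f μ₀ a z') A α - derivWithin (fun a => costJ b f μ₀ a z) A α|
      ≤ ℓJ * |z' - z|

/-! ### Graphons -/

/-- Symmetric, jointly Borel measurable, square-integrable kernels on `I × I`. -/
structure IsGraphon (w : I → I → ℝ) : Prop where
  symm : ∀ x y, w x y = w y x
  measurable : Measurable (fun p : I × I => w p.1 p.2)
  sq_integrable : Integrable (fun p : I × I => w p.1 p.2 ^ 2) volume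

/-- `‖w‖₂`. -/
def l2Norm (w : I → I → ℝ) : ℝ := Real.sqrt (∫ p : I × I, w p.1 p.2 ^ 2)

/-- `[𝐖 g]_x = ∫_I w(x,y) g(y) dy`. -/
def graphonOp (w : I → I → ℝ) (g : I → ℝ) (x : I) : ℝ := ∫ y, w x y * g y

/-- The operator norm `‖𝐖‖` on `L²(I)`. -/
def opNorm (w : I → I → ℝ) : ℝ :=
  sSup {r : ℝ | ∃ φ : L2I, ‖φ‖ = 1 ∧ r = (eLpNorm (graphonOp w φ) 2 volume).toReal}

/-- The cut norm. -/
def cutNorm (w : I → I → ℝ) : ℝ :=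
  sSup {r : ℝ | ∃ S T : Set I, MeasurableSet S ∧ MeasurableSet T ∧
    r = |∫ p in S ×ˢ T, w p.1 p.2|}

/-- The cut metric `d_□(w,w') = ‖w - w'‖_□`. -/
def cutDist (w w' : I → I → ℝ) : ℝ := cutNorm (fun x y => w x y - w' x y)

/-- The interval `[i/N, (i+1)/N)` of player `i`, for `i = 0, …, N-1`. -/
def cell (N : ℕ) (i : Fin N) : Set I :=
  {x : I | ((i : ℕ) : ℝ) / N ≤ (x : ℝ) ∧ (x : ℝ) < (((i : ℕ) : ℝ) + 1) / N}

/-- The step graphon of a matrix: it is `W i j` on `cell N i ×ˢ cell N j` (and `0` on the null set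
where a coordinate is `1`). -/
def stepGraphon {N : ℕ} (W : Matrix (Fin N) (Fin N) ℝ) (x y : I) : ℝ :=
  ∑ i, ∑ j, (cell N i ×ˢ cell N j).indicator (fun _ => W i j) (x, y)

/-- The averages `[μ^N z]_i = N ∫_{cell i} z_x dx`. -/
def cellAverage (N : ℕ) (z : I → ℝ) (i : Fin N) : ℝ := (N : ℝ) * ∫ x in cell N i, z x

/-! ### The graphon game -/

/-- `z_x = ∫_I w(x,y) b(α_y, z_y) dy` for almost every `x`. -/
def IsAggregate (w : I → I → ℝ) (b : ℝ → ℝ → ℝ) (α z : L2I) : Prop :=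
  z =ᵐ[volume] graphonOp w (fun y => b (α y) (z y))

/-- The aggregate operator `𝐙`: the solution of the aggregate equation. -/
def aggregate (w : I → I → ℝ) (b : ℝ → ℝ → ℝ) (α : L2I) : L2I :=
  Classical.epsilon (IsAggregate w b α)

/-- Admissible profiles: elements of `L²(I)` with values in `A`. -/
def IsAdmissible (A : Set ℝ) (α : L2I) : Prop := ∀ᵐ x : I, α x ∈ A

/-- The admissible best responses to the profile `α`. -/
def bestResponses (A : Set ℝ) (b : ℝ → ℝ → ℝ) (f : ℝ → ℝ → ℝ → ℝ) (μ₀ : Measure ℝ)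
    (w : I → I → ℝ) (α : L2I) : Set L2I :=
  {α' | IsAdmissible A α' ∧ ∀ᵐ x : I, ∀ β ∈ A,
    costJ b f μ₀ (α' x) (aggregate w b α x) ≤ costJ b f μ₀ β (aggregate w b α x)}

/-- Nash equilibria of the graphon game: admissible profiles that are best responses to
themselves. -/
def IsGraphonNash (A : Set ℝ) (b : ℝ → ℝ → ℝ) (f : ℝ → ℝ → ℝ → ℝ) (μ₀ : Measure ℝ)
    (w : I → I → ℝ) (α : L2I) : Prop :=
  α ∈ bestResponses A b f μ₀ w α

/-! ### The `N`-player game -/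

/-- The normalized Frobenius norm `‖W‖_F = ((1/N²) ∑ᵢⱼ Wᵢⱼ²)^{1/2}`. -/
def frobNorm {N : ℕ} (W : Matrix (Fin N) (Fin N) ℝ) : ℝ :=
  Real.sqrt ((1 / (N : ℝ) ^ 2) * ∑ i, ∑ j, W i j ^ 2)

/-- `zᵢ = (1/N) ∑ⱼ Wᵢⱼ X_{αⱼ,zⱼ,ξⱼ}` almost surely, for a square-integrable random vector `z`. -/
def IsPlayerAggregate {N : ℕ} {Ω : Type*} [MeasurableSpace Ω] (P : Measure Ω)
    (W : Matrix (Fin N) (Fin N) ℝ) (b : ℝ → ℝ → ℝ) (ξ : Fin N → Ω → ℝ)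
    (α : Fin N → ℝ) (z : Fin N → Lp ℝ 2 P) : Prop :=
  ∀ i, z i =ᵐ[P] fun ω => (1 / (N : ℝ)) * ∑ j, W i j * (b (α j) (z j ω) + ξ j ω)

/-- The operator `𝐙_N`: the solution of the `N`-player aggregate equation. -/
def playerAggregate {N : ℕ} {Ω : Type*} [MeasurableSpace Ω] (P : Measure Ω)
    (W : Matrix (Fin N) (Fin N) ℝ) (b : ℝ → ℝ → ℝ) (ξ : Fin N → Ω → ℝ)
    (α : Fin N → ℝ) : Fin N → Lp ℝ 2 P :=
  Classical.epsilon (IsPlayerAggregate P W b ξ α)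

/-- The aggregate equation has a unique solution in `L²` for every profile in `A^N`. -/
def PlayerAggregateWellDefined {N : ℕ} {Ω : Type*} [MeasurableSpace Ω] (P : Measure Ω)
    (A : Set ℝ) (W : Matrix (Fin N) (Fin N) ℝ) (b : ℝ → ℝ → ℝ) (ξ : Fin N → Ω → ℝ) : Prop :=
  ∀ α : Fin N → ℝ, (∀ i, α i ∈ A) → ∃! z, IsPlayerAggregate P W b ξ α z

/-- The cost `𝒥̃(αᵢ, ℒ(ξᵢ, [𝐙_N α]ᵢ))` of player `i` under the profile `α`. -/
def playerCost {N : ℕ} {Ω : Type*} [MeasurableSpace Ω] (P : Measure Ω)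
    (W : Matrix (Fin N) (Fin N) ℝ) (b : ℝ → ℝ → ℝ) (f : ℝ → ℝ → ℝ → ℝ) (ξ : Fin N → Ω → ℝ)
    (α : Fin N → ℝ) (i : Fin N) : ℝ :=
  costJTilde b f (α i) (P.map fun ω => (ξ i ω, playerAggregate P W b ξ α i ω))

/-- `α ∈ A^N` is an `ε`-Nash equilibrium of the `N`-player game. -/
def IsEpsNash {N : ℕ} {Ω : Type*} [MeasurableSpace Ω] (P : Measure Ω) (A : Set ℝ)
    (W : Matrix (Fin N) (Fin N) ℝ) (b : ℝ → ℝ → ℝ) (f : ℝ → ℝ → ℝ → ℝ) (ξ : Fin N → Ω → ℝ)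
    (ε : ℝ) (α : Fin N → ℝ) : Prop :=
  (∀ i, α i ∈ A) ∧ ∀ i, ∀ β ∈ A,
    playerCost P W b f ξ α i ≤ playerCost P W b f ξ (Function.update α i β) i + ε

end

end GraphonGame

open GraphonGame

/-! Let `z` be the aggregate of the equilibrium `α`, let `g j` be the mean of the drift `b(α, z)`
over cell `j`, and set `c i = (1/N) ∑ j, W i j * g j`. The proof replaces every random aggregate of
player `i` by the deterministic number `c i`. In the continuum, the operator of the step graphon
sends the drift of `α` to `c i` on cell `i`. The cut norm controls the action of a kernel on bounded
functions in L¹, so the mean of `|z - c i|` over cell `i` is at most `4 * c₀ * N * γ`; the factor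
`N` normalises the cell, whence the rate `N γ_N → 0`. Strong convexity makes minimizers 1/2-Hölder
in the aggregate (`sq_sub_le_of_minimizers`), so `α`, and with it the drift, is also nearly constant
on each cell. In the `N`-player game, the L² distances of the aggregates to `c` satisfy a system of
inequalities that contracts in the Frobenius norm. This bounds their effect on average over players;
the row estimates `row_mul_le` and `row_sq_le`, drawn from the cut distance and the row bound on
`w`, upgrade it to each single player (`sqrt_integral_playerAggregate_le`). A unilateral deviation
moves one action by at most the diameter of `A`, which costs only `O(1/√N)`, so the same `c i`
serves before and after it. Finally the tangent line of the convex cost at the cell mean of `α`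
shows that this mean nearly minimizes `𝒥(·, c i)` (`costJ_integral_le`). -/

namespace GraphonGame

/-! ### Regularity of the costs and stability of their minimizers -/

section Cost

variable {A : Set ℝ} {b : ℝ → ℝ → ℝ} {f : ℝ → ℝ → ℝ → ℝ} {μ₀ : Measure ℝ}

theorem NoiseLaw.memLp_two {Ω : Type*} [MeasurableSpace Ω] {P : Measure Ω} {X : Ω → ℝ}
    (hμ₀ : NoiseLaw μ₀) (hX : HasLaw X μ₀ P) : MemLp X 2 P := by
  have h : MemLp (id : ℝ → ℝ) 2 (P.map X) := by
    rw [hX.map_eq]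
    exact (memLp_two_iff_integrable_sq measurable_id.aestronglyMeasurable).2 hμ₀.second_moment
  exact h.comp_of_map hX.aemeasurable

theorem isJointLaw_map {Ω : Type*} [MeasurableSpace Ω] {P : Measure Ω} [IsProbabilityMeasure P]
    {X Y : Ω → ℝ} (hμ₀ : NoiseLaw μ₀) (hX : HasLaw X μ₀ P) (hY : MemLp Y 2 P) :
    IsJointLaw μ₀ (P.map fun ω => (X ω, Y ω)) := by
  have hm : AEMeasurable (fun ω => (X ω, Y ω)) P :=
    hX.aemeasurable.prodMk hY.aestronglyMeasurable.aemeasurable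
  refine ⟨Measure.isProbabilityMeasure_map hm, ?_, ?_⟩
  · rw [AEMeasurable.map_map_of_aemeasurable measurable_fst.aemeasurable hm]
    exact hX.map_eq
  · rw [integrable_map_measure (by fun_prop) hm]
    exact (hμ₀.memLp_two hX).integrable_sq.add hY.integrable_sq

/-- The coupling that keeps the same noise in both pairs pays nothing in the first coordinate. -/
theorem wasserstein2_map_le {Ω : Type*} [MeasurableSpace Ω] {P : Measure Ω}
    {X Y Y' : Ω → ℝ} (hX : AEMeasurable X P) (hY : MemLp Y 2 P) (hY' : MemLp Y' 2 P) :
    wasserstein2 (P.map fun ω => (X ω, Y ω)) (P.map fun ω => (X ω, Y' ω)) ≤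
      √(∫ ω, (Y ω - Y' ω) ^ 2 ∂P) := by
  have hm : AEMeasurable (fun ω => (X ω, Y ω)) P :=
    hX.prodMk hY.aestronglyMeasurable.aemeasurable
  have hm' : AEMeasurable (fun ω => (X ω, Y' ω)) P :=
    hX.prodMk hY'.aestronglyMeasurable.aemeasurable
  have hc : IsCoupling (P.map fun ω => (X ω, Y ω)) (P.map fun ω => (X ω, Y' ω))
      (P.map fun ω => ((X ω, Y ω), (X ω, Y' ω))) := by
    constructor
    · rw [AEMeasurable.map_map_of_aemeasurable measurable_fst.aemeasurable (hm.prodMk hm')]; rfl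
    · rw [AEMeasurable.map_map_of_aemeasurable measurable_snd.aemeasurable (hm.prodMk hm')]; rfl
  have hval : ∫⁻ q, ENNReal.ofReal ((q.1.1 - q.2.1) ^ 2 + (q.1.2 - q.2.2) ^ 2)
      ∂(P.map fun ω => ((X ω, Y ω), (X ω, Y' ω))) =
      ENNReal.ofReal (∫ ω, (Y ω - Y' ω) ^ 2 ∂P) := by
    have h := ofReal_integral_eq_lintegral_ofReal (hY.sub hY').integrable_sq
      (ae_of_all _ fun ω => sq_nonneg _)
    simp only [Pi.sub_apply] at h
    rw [lintegral_map' (by fun_prop) (hm.prodMk hm'), h]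
    simp
  unfold wasserstein2
  apply Real.sqrt_le_sqrt
  rw [← ENNReal.toReal_ofReal (integral_nonneg fun ω => sq_nonneg (Y ω - Y' ω)), ← hval]
  refine ENNReal.toReal_mono (by rw [hval]; exact ENNReal.ofReal_ne_top) ?_
  exact iInf₂_le _ hc

theorem CostWassersteinLipschitz.abs_sub_le {ℓ : ℝ} (hJt : CostWassersteinLipschitz A b f μ₀ ℓ)
    (hμ₀ : NoiseLaw μ₀) {a : ℝ} (ha : a ∈ A)
    {Ω : Type*} [MeasurableSpace Ω] {P : Measure Ω} [IsProbabilityMeasure P]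
    {X Y Y' : Ω → ℝ} (hX : HasLaw X μ₀ P) (hY : MemLp Y 2 P) (hY' : MemLp Y' 2 P) :
    |costJTilde b f a (P.map fun ω => (X ω, Y' ω)) - costJTilde b f a (P.map fun ω => (X ω, Y ω))|
      ≤ ℓ * √(∫ ω, (Y ω - Y' ω) ^ 2 ∂P) :=
  (hJt.lipschitz a ha _ _ (isJointLaw_map hμ₀ hX hY) (isJointLaw_map hμ₀ hX hY')).trans
    (mul_le_mul_of_nonneg_left (wasserstein2_map_le hX.aemeasurable hY hY') hJt.nonneg)

theorem CostWassersteinLipschitz.costJTilde_map_const {ℓ : ℝ}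
    (hJt : CostWassersteinLipschitz A b f μ₀ ℓ)
    (hμ₀ : NoiseLaw μ₀) {a : ℝ} (ha : a ∈ A)
    {Ω : Type*} [MeasurableSpace Ω] {P : Measure Ω} [IsProbabilityMeasure P]
    {X : Ω → ℝ} (hX : HasLaw X μ₀ P) (c : ℝ) :
    costJTilde b f a (P.map fun ω => (X ω, c)) = costJ b f μ₀ a c := by
  have hprob := hμ₀.prob
  have h0 : HasLaw (id : ℝ → ℝ) μ₀ μ₀ := ⟨aemeasurable_id, Measure.map_id⟩
  have h1 : (P.map fun ω => (X ω, c)) = μ₀.map fun x => (x, c) := by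
    rw [← hX.map_eq, AEMeasurable.map_map_of_aemeasurable (by fun_prop) hX.aemeasurable]
    rfl
  -- No measurability of `f` is assumed; what the change of variables needs comes from integrability
  -- at this joint law.
  have h2 : Integrable (fun p : ℝ × ℝ => f (b a p.2 + p.1) a p.2) (μ₀.map fun x => (x, c)) :=
    hJt.integrable a ha _ (isJointLaw_map hμ₀ h0 (memLp_const c))
  unfold costJTilde costJ
  rw [h1, integral_map (by fun_prop) h2.aestronglyMeasurable]

/-- Deterministic aggregates give admissible joint laws, so the Wasserstein hypothesis contains an
ordinary Lipschitz bound. -/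
theorem CostWassersteinLipschitz.abs_costJ_sub_le {ℓ : ℝ}
    (hJt : CostWassersteinLipschitz A b f μ₀ ℓ)
    (hμ₀ : NoiseLaw μ₀) {a : ℝ} (ha : a ∈ A) (z z' : ℝ) :
    |costJ b f μ₀ a z' - costJ b f μ₀ a z| ≤ ℓ * |z - z'| := by
  have hprob := hμ₀.prob
  have h0 : HasLaw (id : ℝ → ℝ) μ₀ μ₀ := ⟨aemeasurable_id, Measure.map_id⟩
  have h := hJt.abs_sub_le hμ₀ ha h0 (memLp_const z) (memLp_const z')
  rw [hJt.costJTilde_map_const hμ₀ ha h0, hJt.costJTilde_map_const hμ₀ ha h0] at h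
  simpa [Real.sqrt_sq_eq_abs] using h

/-- Minimizers of the cost depend on the aggregate in a Hölder way. -/
theorem sq_sub_le_of_minimizers {ℓ ℓc ℓJ : ℝ}
    (hJt : CostWassersteinLipschitz A b f μ₀ ℓ) (hJ : CostConvex A b f μ₀ ℓc ℓJ)
    (hμ₀ : NoiseLaw μ₀) {a a' z z' : ℝ} (ha : a ∈ A) (ha' : a' ∈ A)
    (hmin : ∀ β ∈ A, costJ b f μ₀ a z ≤ costJ b f μ₀ β z)
    (hmin' : ∀ β ∈ A, costJ b f μ₀ a' z' ≤ costJ b f μ₀ β z') :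
    (a - a') ^ 2 ≤ 4 * ℓ / ℓc * |z - z'| := by
  -- Each minimizer is compared with the midpoint: at `z` the action `a'` costs at least `ℓc / 4 *
  -- (a - a') ^ 2` more than `a`, and symmetrically at `z'`. Adding the two gains and swapping `z`
  -- for `z'` costs `2 * ℓ * |z - z'|`, hence the constant `4 * ℓ / ℓc`.
  have hmid : (1 / 2 : ℝ) • a + (1 / 2 : ℝ) • a' ∈ A :=
    (hJ.strongConvex 0).1 ha ha' (by norm_num) (by norm_num) (by norm_num)
  have s := (hJ.strongConvex z).2 ha ha' (show (0 : ℝ) ≤ 1 / 2 by norm_num)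
    (show (0 : ℝ) ≤ 1 / 2 by norm_num) (by norm_num)
  have s' := (hJ.strongConvex z').2 ha ha' (show (0 : ℝ) ≤ 1 / 2 by norm_num)
    (show (0 : ℝ) ≤ 1 / 2 by norm_num) (by norm_num)
  have m := hmin _ hmid
  have m' := hmin' _ hmid
  have l := abs_le.1 (hJt.abs_costJ_sub_le hμ₀ ha z z')
  have l' := abs_le.1 (hJt.abs_costJ_sub_le hμ₀ ha' z z')
  simp only [Real.norm_eq_abs, sq_abs, smul_eq_mul] at s s' m m'
  have hℓc := hJ.ℓc_pos
  rw [div_mul_eq_mul_div, le_div_iff₀ hℓc]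
  linarith [l.1, l.2, l'.1, l'.2]

theorem convexOn_add_derivWithin_mul_le {g : ℝ → ℝ} (hg : ConvexOn ℝ A g)
    {x y : ℝ} (hd : DifferentiableWithinAt ℝ g A x) (hx : x ∈ A) (hy : y ∈ A) :
    g x + derivWithin g A x * (y - x) ≤ g y := by
  rcases lt_trichotomy x y with h | h | h
  · have := hg.le_slope_of_hasDerivWithinAt hx hy h hd.hasDerivWithinAt
    rw [slope_def_field, le_div_iff₀ (sub_pos.2 h)] at this
    linarith
  · simp [h]
  · have := hg.slope_le_of_hasDerivWithinAt hy hx h hd.hasDerivWithinAt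
    rw [slope_def_field, div_le_iff₀ (sub_pos.2 h)] at this
    linarith

/-- `A` need not be closed. On the line it suffices that the mean lies between two values taken off
the exceptional null set. -/
theorem integral_mem_of_convex {X : Type*} [MeasurableSpace X] {ν : Measure X}
    [IsProbabilityMeasure ν] (hA : Convex ℝ A) {u : X → ℝ} (hu : Integrable u ν)
    (huA : ∀ᵐ x ∂ν, u x ∈ A) : ∫ x, u x ∂ν ∈ A := by
  have hN : ν {x | u x ∉ A} = 0 := huA
  obtain ⟨x, hx, hxl⟩ := exists_notMem_null_le_integral hu hN
  obtain ⟨y, hy, hyl⟩ := exists_notMem_null_integral_le hu hN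
  simp only [Set.mem_ofPred_eq, not_not] at hx hy
  exact hA.ordConnected.out hx hy ⟨hxl, hyl⟩

/-- The mean of a profile of minimizers is nearly a minimizer for an aggregate near theirs. -/
theorem costJ_integral_le {X : Type*} [MeasurableSpace X] {ν : Measure X}
    [IsProbabilityMeasure ν] {ℓ ℓc ℓJ : ℝ} (hA : Convex ℝ A)
    (hJt : CostWassersteinLipschitz A b f μ₀ ℓ) (hJ : CostConvex A b f μ₀ ℓc ℓJ)
    (hμ₀ : NoiseLaw μ₀) {u z : X → ℝ} (hu : Integrable u ν) (hz : Integrable z ν)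
    (huA : ∀ᵐ x ∂ν, u x ∈ A)
    (hmin : ∀ᵐ x ∂ν, ∀ β ∈ A, costJ b f μ₀ (u x) (z x) ≤ costJ b f μ₀ β (z x))
    {β : ℝ} (hβ : β ∈ A) (c : ℝ) :
    costJ b f μ₀ (∫ x, u x ∂ν) c ≤ costJ b f μ₀ β c + 2 * ℓ * ∫ x, |z x - c| ∂ν := by
  have hm := integral_mem_of_convex hA hu huA
  set m := ∫ x, u x ∂ν with hmdef
  have hconv : ConvexOn ℝ A (fun α => costJ b f μ₀ α c) :=
    ((hJ.strongConvex c).strictConvexOn hJ.ℓc_pos).convexOn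
  have hd : DifferentiableWithinAt ℝ (fun α => costJ b f μ₀ α c) A m :=
    (hJ.contDiff c).differentiableOn (by norm_num) m hm
  set d := derivWithin (fun α => costJ b f μ₀ α c) A m
  have hzc : Integrable (fun x => |z x - c|) ν := (hz.sub (integrable_const c)).abs
  have hle : ∀ᵐ x ∂ν, costJ b f μ₀ m c + d * (u x - m) ≤
      costJ b f μ₀ β c + 2 * ℓ * |z x - c| := by
    filter_upwards [huA, hmin] with x hx hxm
    -- Tangent line at the mean `m`, whose linear term integrates to zero. The factor 2 arises from
    -- exchanging `z x` and `c` once for the action `u x` and once for `β`.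
    have h1 := convexOn_add_derivWithin_mul_le hconv hd hm hx
    have h2 := hxm β hβ
    have h3 := (abs_le.1 (hJt.abs_costJ_sub_le hμ₀ hx (z x) c)).2
    have h4 := (abs_le.1 (hJt.abs_costJ_sub_le hμ₀ hβ (z x) c)).1
    linarith
  have hi1 : Integrable (fun x => d * (u x - m)) ν := (hu.sub (integrable_const m)).const_mul d
  have hint := integral_mono_ae ((integrable_const _).add hi1)
    ((integrable_const _).add (hzc.const_mul (2 * ℓ))) hle
  simp only [Pi.add_apply] at hint
  rw [integral_add (integrable_const _) hi1,
    integral_add (integrable_const _) (hzc.const_mul (2 * ℓ)), integral_const_mul,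
    integral_const_mul, integral_sub hu (integrable_const m)] at hint
  simpa [← hmdef] using hint

/-- An AM–GM form of `|x| ≤ √s` that is linear in `s`, so that it can be integrated; `δ` is chosen
at the end. -/
theorem le_div_add_self_of_sq_le {x s δ : ℝ} (hδ : 0 < δ) (h : x ^ 2 ≤ s) :
    |x| ≤ (s / δ + δ) / 2 := by
  rw [div_add' _ _ _ hδ.ne', div_div, le_div_iff₀ (by positivity)]
  nlinarith [sq_nonneg (|x| - δ), sq_abs x]

/-- A profile of minimizers is nearly constant where the aggregate is. -/
theorem integral_abs_sub_integral_le {X : Type*} [MeasurableSpace X] {ν : Measure X}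
    [IsProbabilityMeasure ν] {ℓ ℓc ℓJ : ℝ}
    (hJt : CostWassersteinLipschitz A b f μ₀ ℓ) (hJ : CostConvex A b f μ₀ ℓc ℓJ)
    (hμ₀ : NoiseLaw μ₀) {u z : X → ℝ} (hu : Integrable u ν) (hz : Integrable z ν)
    (huA : ∀ᵐ x ∂ν, u x ∈ A)
    (hmin : ∀ᵐ x ∂ν, ∀ β ∈ A, costJ b f μ₀ (u x) (z x) ≤ costJ b f μ₀ β (z x))
    (c : ℝ) {δ : ℝ} (hδ : 0 < δ) :
    ∫ x, |u x - ∫ y, u y ∂ν| ∂ν ≤ 2 * (4 * ℓ / ℓc) * (∫ x, |z x - c| ∂ν) / δ + δ := by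
  have hzc : Integrable (fun x => |z x - c|) ν := (hz.sub (integrable_const c)).abs
  set E := ∫ x, |z x - c| ∂ν with hE
  set K := 4 * ℓ / ℓc with hK
  have hK0 : 0 ≤ K := div_nonneg (mul_nonneg (by norm_num) hJt.nonneg) hJ.ℓc_pos.le
  have hgood := huA.and hmin
  -- A good point where `|z y - c|` is at most its mean serves as reference. Passing from `u y` to
  -- the mean of `u` later doubles the bound.
  obtain ⟨y, hy, hyl⟩ := exists_notMem_null_le_integral hzc hgood
  simp only [Set.mem_compl_iff, Set.mem_ofPred_eq, not_not] at hy
  have hpt : ∀ᵐ x ∂ν, |u x - u y| ≤ (K * (|z x - c| + E) / δ + δ) / 2 := by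
    filter_upwards [hgood] with x hx
    refine le_div_add_self_of_sq_le hδ ?_
    refine (sq_sub_le_of_minimizers hJt hJ hμ₀ hx.1 hy.1 hx.2 hy.2).trans ?_
    refine mul_le_mul_of_nonneg_left ?_ hK0
    calc |z x - z y| = |(z x - c) - (z y - c)| := by ring_nf
      _ ≤ |z x - c| + |z y - c| := abs_sub _ _
      _ ≤ _ := by linarith
  have hi : Integrable (fun x => |u x - u y|) ν := (hu.sub (integrable_const _)).abs
  have hS : ∫ x, |u x - u y| ∂ν ≤ (2 * K * E / δ + δ) / 2 := by
    have h1 : Integrable (fun x => K * (|z x - c| + E) / δ) ν :=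
      (((hzc.add (integrable_const E)).const_mul K).div_const δ)
    have h2 := integral_mono_ae hi ((h1.add (integrable_const δ)).div_const 2) hpt
    refine h2.trans (le_of_eq ?_)
    simp only [Pi.add_apply]
    rw [integral_div, integral_add h1 (integrable_const _), integral_div, integral_const_mul,
      integral_add hzc (integrable_const _)]
    simp
    ring
  have hm : |u y - ∫ x, u x ∂ν| ≤ ∫ x, |u x - u y| ∂ν := by
    have : u y - ∫ x, u x ∂ν = ∫ x, (u y - u x) ∂ν := by
      rw [integral_sub (integrable_const _) hu]; simp
    rw [this]
    refine (abs_integral_le_integral_abs).trans (le_of_eq ?_)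
    simp only [abs_sub_comm]
  have h3 : ∫ x, |u x - ∫ y, u y ∂ν| ∂ν ≤ ∫ x, (|u x - u y| + |u y - ∫ x, u x ∂ν|) ∂ν :=
    integral_mono (hu.sub (integrable_const _)).abs (hi.add (integrable_const _))
      fun x => abs_sub_le _ _ _
  rw [integral_add hi (integrable_const _)] at h3
  simp at h3
  linarith

end Cost

/-! ### L² norms as integrals, Cauchy–Schwarz, and L¹ norms from set integrals -/

section IntegralInequalities

variable {X : Type*} [MeasurableSpace X] {μ : Measure X}

theorem norm_toLp_sq_eq_integral {h : X → ℝ} (hh : MemLp h 2 μ) :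
    ‖hh.toLp h‖ ^ 2 = ∫ x, h x ^ 2 ∂μ := by
  rw [← real_inner_self_eq_norm_sq, L2.inner_def]
  refine integral_congr_ae ?_
  filter_upwards [hh.coeFn_toLp] with x hx
  simp [hx, sq]

theorem norm_lp_sq_eq_integral (h : Lp ℝ 2 μ) : ‖h‖ ^ 2 = ∫ x, h x ^ 2 ∂μ := by
  rw [← norm_toLp_sq_eq_integral (Lp.memLp h), Lp.toLp_coeFn]

theorem integral_sq_eq_eLpNorm_sq {h : X → ℝ} (hh : MemLp h 2 μ) :
    ∫ x, h x ^ 2 ∂μ = (eLpNorm h 2 μ).toReal ^ 2 := by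
  rw [← norm_toLp_sq_eq_integral hh, Lp.norm_toLp]

theorem sq_integral_mul_le {g h : X → ℝ} (hg : MemLp g 2 μ) (hh : MemLp h 2 μ) :
    (∫ x, g x * h x ∂μ) ^ 2 ≤ (∫ x, g x ^ 2 ∂μ) * ∫ x, h x ^ 2 ∂μ := by
  have h1 : ∫ x, g x * h x ∂μ = inner ℝ (hg.toLp g) (hh.toLp h) := by
    rw [L2.inner_def]
    refine integral_congr_ae ?_
    filter_upwards [hg.coeFn_toLp, hh.coeFn_toLp] with x hx hx'
    simp [hx, hx', mul_comm]
  rw [h1, ← norm_toLp_sq_eq_integral hg, ← norm_toLp_sq_eq_integral hh, ← mul_pow, ← sq_abs]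
  exact pow_le_pow_left₀ (abs_nonneg _) (abs_real_inner_le_norm _ _) 2

theorem sq_integral_le [IsFiniteMeasure μ] {h : X → ℝ} (hh : MemLp h 2 μ) :
    (∫ x, h x ∂μ) ^ 2 ≤ μ.real Set.univ * ∫ x, h x ^ 2 ∂μ := by
  simpa using sq_integral_mul_le (memLp_const (1 : ℝ)) hh

/-- A function whose integrals over measurable sets are at most `m` has `L¹` norm at most `2m`. -/
theorem integral_abs_le_of_forall_setIntegral {h : X → ℝ} (hh : Integrable h μ) {m : ℝ}
    (hm : ∀ T, MeasurableSet T → |∫ x in T, h x ∂μ| ≤ m) : ∫ x, |h x| ∂μ ≤ 2 * m := by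
  set k := hh.1.mk h
  have hk : h =ᵐ[μ] k := hh.1.ae_eq_mk
  have hT : MeasurableSet {x | 0 ≤ k x} :=
    measurableSet_le measurable_const hh.1.stronglyMeasurable_mk.measurable
  rw [← integral_add_compl hT hh.abs]
  have h1 : ∫ x in {x | 0 ≤ k x}, |h x| ∂μ = ∫ x in {x | 0 ≤ k x}, h x ∂μ := by
    refine setIntegral_congr_ae hT ?_
    filter_upwards [hk] with x hx hxT
    rw [abs_of_nonneg]
    rw [hx]; exact hxT
  have h2 : ∫ x in {x | 0 ≤ k x}ᶜ, |h x| ∂μ = -∫ x in {x | 0 ≤ k x}ᶜ, h x ∂μ := by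
    rw [← integral_neg]
    refine setIntegral_congr_ae hT.compl ?_
    filter_upwards [hk] with x hx hxT
    rw [abs_of_nonpos]
    rw [hx]; exact le_of_not_ge hxT
  rw [h1, h2]
  have a1 := (abs_le.1 (hm _ hT)).2
  have a2 := (abs_le.1 (hm _ hT.compl)).1
  linarith

end IntegralInequalities

/-! ### The partition of the unit interval into players -/

section Cells

variable {N : ℕ}

theorem measurableSet_cell (i : Fin N) : MeasurableSet (cell N i) :=
  (measurableSet_le measurable_const measurable_subtype_coe).inter
    (measurableSet_lt measurable_subtype_coe measurable_const)

theorem natCast_pos_of_fin (i : Fin N) : (0 : ℝ) < N := by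
  exact_mod_cast (Nat.zero_le _).trans_lt i.2

theorem volume_cell (i : Fin N) : volume (cell N i) = ENNReal.ofReal (1 / N) := by
  have hN := natCast_pos_of_fin i
  have h : Subtype.val '' (cell N i) = Set.Ico (((i : ℕ) : ℝ) / N) ((((i : ℕ) : ℝ) + 1) / N) := by
    ext x
    constructor
    · rintro ⟨y, hy, rfl⟩
      exact hy
    · rintro ⟨h1, h2⟩
      have hi : ((i : ℕ) : ℝ) + 1 ≤ N := by exact_mod_cast i.2
      refine ⟨⟨x, (by positivity : (0 : ℝ) ≤ ((i : ℕ) : ℝ) / N).trans h1, ?_⟩, ⟨h1, h2⟩, rfl⟩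
      exact h2.le.trans ((div_le_one hN).2 hi)
  rw [unitInterval.volume_apply, h, Real.volume_Ico]
  congr 1
  ring

theorem volume_real_cell (i : Fin N) : volume.real (cell N i) = 1 / N := by
  rw [Measure.real, volume_cell, ENNReal.toReal_ofReal (by positivity)]

theorem pairwise_disjoint_cell : Pairwise (Function.onFun Disjoint (cell N)) := by
  intro i j hij
  rw [Function.onFun, Set.disjoint_left]
  rintro x ⟨h1, h2⟩ ⟨h3, h4⟩
  have hN := natCast_pos_of_fin i
  have a : ((i : ℕ) : ℝ) < ((j : ℕ) : ℝ) + 1 := (div_lt_div_iff_of_pos_right hN).1 (h1.trans_lt h4)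
  have b : ((j : ℕ) : ℝ) < ((i : ℕ) : ℝ) + 1 := (div_lt_div_iff_of_pos_right hN).1 (h3.trans_lt h2)
  have a' : (i : ℕ) < j + 1 := by exact_mod_cast a
  have b' : (j : ℕ) < i + 1 := by exact_mod_cast b
  exact hij (Fin.ext (by omega))

theorem ae_mem_iUnion_cell (hN : 1 ≤ N) : ∀ᵐ x : I, x ∈ ⋃ i, cell N i := by
  have h1 : ∀ᵐ x : I, x ≠ 1 := by
    rw [ae_iff]
    simp
  filter_upwards [h1] with x hx
  have hN0 : (0 : ℝ) < N := by exact_mod_cast hN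
  have hx1 : (x : ℝ) < 1 := lt_of_le_of_ne x.2.2 fun h => hx (Subtype.ext h)
  have hfl : ⌊(x : ℝ) * N⌋₊ < N := by
    rw [Nat.floor_lt (mul_nonneg x.2.1 hN0.le)]
    nlinarith
  refine Set.mem_iUnion.2 ⟨⟨⌊(x : ℝ) * N⌋₊, hfl⟩, ?_, ?_⟩
  · rw [div_le_iff₀ hN0]
    exact Nat.floor_le (mul_nonneg x.2.1 hN0.le)
  · rw [lt_div_iff₀ hN0]
    exact Nat.lt_floor_add_one _

theorem sum_setIntegral_cell (hN : 1 ≤ N) {h : I → ℝ} (hh : Integrable h) :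
    ∑ i, ∫ x in cell N i, h x = ∫ x, h x := by
  rw [← integral_iUnion_fintype measurableSet_cell pairwise_disjoint_cell
    fun i => hh.integrableOn, ← setIntegral_univ (μ := volume) (f := h)]
  exact setIntegral_congr_set (eventuallyEq_univ.2 (ae_mem_iUnion_cell hN))

/-- The uniform distribution on the interval of player `i`. -/
noncomputable def cellMeasure (N : ℕ) (i : Fin N) : Measure I :=
  (N : ℝ≥0∞) • volume.restrict (cell N i)

instance (i : Fin N) : IsProbabilityMeasure (cellMeasure N i) := by
  constructor
  have hN := natCast_pos_of_fin i
  rw [cellMeasure, Measure.smul_apply, Measure.restrict_apply_univ, volume_cell, smul_eq_mul,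
    ← ENNReal.ofReal_natCast, ← ENNReal.ofReal_mul hN.le, mul_one_div_cancel hN.ne',
    ENNReal.ofReal_one]

theorem integral_cellMeasure (h : I → ℝ) (i : Fin N) :
    ∫ x, h x ∂cellMeasure N i = (N : ℝ) * ∫ x in cell N i, h x := by
  rw [cellMeasure, integral_smul_measure]
  simp

theorem cellMeasure_absolutelyContinuous (i : Fin N) : cellMeasure N i ≪ volume :=
  Measure.smul_absolutelyContinuous.trans
    (Measure.absolutelyContinuous_of_le Measure.restrict_le_self)

theorem integrable_cellMeasure {h : I → ℝ} (hh : Integrable h) (i : Fin N) :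
    Integrable h (cellMeasure N i) :=
  hh.restrict.smul_measure (ENNReal.natCast_ne_top N)

end Cells

/-! ### Step graphons as matrices -/

section StepGraphon

variable {N : ℕ} (W : Matrix (Fin N) (Fin N) ℝ)

theorem stepGraphon_apply {i j : Fin N} {x y : I} (hx : x ∈ cell N i) (hy : y ∈ cell N j) :
    stepGraphon W x y = W i j := by
  have hne : ∀ {k l : Fin N} {u : I}, u ∈ cell N l → k ≠ l → u ∉ cell N k := fun hu hkl hu' =>
    Set.disjoint_left.1 (pairwise_disjoint_cell hkl) hu' hu
  unfold stepGraphon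
  rw [Finset.sum_eq_single i, Finset.sum_eq_single j]
  · exact Set.indicator_of_mem (Set.mk_mem_prod hx hy) _
  · intro k _ hk
    exact Set.indicator_of_notMem (fun h => hne hy hk h.2) _
  · simp
  · intro k _ hk
    exact Finset.sum_eq_zero fun l _ => Set.indicator_of_notMem (fun h => hne hx hk h.1) _
  · simp

theorem measurable_stepGraphon : Measurable (fun p : I × I => stepGraphon W p.1 p.2) := by
  unfold stepGraphon
  refine Finset.measurable_sum _ fun i _ => Finset.measurable_sum _ fun j _ => ?_
  exact measurable_const.indicator ((measurableSet_cell i).prod (measurableSet_cell j))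

theorem abs_stepGraphon_le (x y : I) : |stepGraphon W x y| ≤ ∑ i, ∑ j, |W i j| := by
  unfold stepGraphon
  refine (Finset.abs_sum_le_sum_abs _ _).trans (Finset.sum_le_sum fun i _ => ?_)
  refine (Finset.abs_sum_le_sum_abs _ _).trans (Finset.sum_le_sum fun j _ => ?_)
  by_cases h : (x, y) ∈ cell N i ×ˢ cell N j
  · rw [Set.indicator_of_mem h]
  · rw [Set.indicator_of_notMem h]; simp

theorem memLp_stepGraphon (p : ℝ≥0∞) : MemLp (fun q : I × I => stepGraphon W q.1 q.2) p volume :=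
  MemLp.of_bound (measurable_stepGraphon W).aestronglyMeasurable _
    (ae_of_all _ fun q => abs_stepGraphon_le W q.1 q.2)

theorem memLp_stepGraphon_row (p : ℝ≥0∞) (x : I) : MemLp (stepGraphon W x) p volume :=
  MemLp.of_bound ((measurable_stepGraphon W).comp measurable_prodMk_left).aestronglyMeasurable _
    (ae_of_all _ fun y => abs_stepGraphon_le W x y)

theorem setIntegral_prod_cell (h : ℝ → ℝ) (i j : Fin N) :
    ∫ p in cell N i ×ˢ cell N j, h (stepGraphon W p.1 p.2) = h (W i j) / N ^ 2 := by
  rw [setIntegral_congr_fun ((measurableSet_cell i).prod (measurableSet_cell j))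
    (g := fun _ => h (W i j)) fun p hp => by rw [stepGraphon_apply W hp.1 hp.2]]
  rw [setIntegral_const, Measure.volume_eq_prod, measureReal_prod_prod, volume_real_cell,
    volume_real_cell, smul_eq_mul]
  ring

/-- The bridge between the two games: applied to the equilibrium drift, this constant is the
deterministic aggregate around which player `i` is studied. -/
theorem graphonOp_stepGraphon {g : I → ℝ} (hN : 1 ≤ N) (hg : Integrable g) {i : Fin N} {x : I}
    (hx : x ∈ cell N i) :
    graphonOp (stepGraphon W) g x = (1 / (N : ℝ)) * ∑ j, W i j * cellAverage N g j := by
  have hN0 : (N : ℝ) ≠ 0 := (natCast_pos_of_fin i).ne'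
  unfold graphonOp
  have hint : Integrable (fun y => stepGraphon W x y * g y) :=
    hg.bdd_mul (memLp_stepGraphon_row W 2 x).aestronglyMeasurable
      (ae_of_all _ fun y => abs_stepGraphon_le W x y)
  rw [← sum_setIntegral_cell hN hint, Finset.mul_sum]
  refine Finset.sum_congr rfl fun j _ => ?_
  rw [setIntegral_congr_fun (measurableSet_cell j) (g := fun y => W i j * g y)
    fun y hy => by simp only [stepGraphon_apply W hx hy], integral_const_mul, cellAverage]
  field_simp

/-- Turns the assumed convergence of L² norms into that of the contraction constants of the finite
games. -/
theorem l2Norm_stepGraphon (hN : 1 ≤ N) : l2Norm (stepGraphon W) = frobNorm W := by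
  unfold l2Norm frobNorm
  congr 1
  have hi : Integrable (fun p : I × I => stepGraphon W p.1 p.2 ^ 2) volume :=
    (memLp_stepGraphon W 2).integrable_sq
  rw [Measure.volume_eq_prod] at hi ⊢
  rw [integral_prod _ hi, ← sum_setIntegral_cell hN hi.integral_prod_left, Finset.mul_sum]
  refine Finset.sum_congr rfl fun i _ => ?_
  have hrow : ∀ x ∈ cell N i, ∫ y, stepGraphon W x y ^ 2 = (1 / (N : ℝ)) * ∑ j, W i j ^ 2 := by
    intro x hx
    rw [← sum_setIntegral_cell hN (memLp_stepGraphon_row W 2 x).integrable_sq, Finset.mul_sum]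
    refine Finset.sum_congr rfl fun j _ => ?_
    rw [setIntegral_congr_fun (measurableSet_cell j) (g := fun y => W i j ^ 2)
      fun y hy => by simp only [stepGraphon_apply W hx hy], setIntegral_const, volume_real_cell,
      smul_eq_mul]
  rw [setIntegral_congr_fun (measurableSet_cell i) hrow, setIntegral_const, volume_real_cell,
    smul_eq_mul]
  ring

end StepGraphon

/-! ### The cut norm and bounded functions -/

section CutNorm

variable {k : I → I → ℝ}

theorem abs_setIntegral_le_cutNorm (hk : Integrable (fun p : I × I => k p.1 p.2)) {S T : Set I}
    (hS : MeasurableSet S) (hT : MeasurableSet T) :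
    |∫ p in S ×ˢ T, k p.1 p.2| ≤ cutNorm k := by
  -- A real `sSup` bounds its elements only if the set is bounded above; the L¹ norm of `k` is a
  -- bound.
  refine le_csSup ⟨∫ p : I × I, |k p.1 p.2|, ?_⟩ ⟨S, T, hS, hT, rfl⟩
  rintro r ⟨S, T, -, -, rfl⟩
  exact abs_integral_le_integral_abs.trans
    (setIntegral_le_integral hk.abs (ae_of_all _ fun p => abs_nonneg _))

theorem cutNorm_nonneg (hk : Integrable (fun p : I × I => k p.1 p.2)) : 0 ≤ cutNorm k :=
  (abs_nonneg _).trans (abs_setIntegral_le_cutNorm hk MeasurableSet.empty MeasurableSet.empty)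

theorem integrable_prod_restrict (hk : Integrable (fun p : I × I => k p.1 p.2)) (S T : Set I) :
    Integrable (fun p : I × I => k p.1 p.2) ((volume.restrict S).prod (volume.restrict T)) := by
  rw [Measure.prod_restrict]
  exact hk.integrableOn

theorem integrable_setIntegral_fst (hk : Integrable (fun p : I × I => k p.1 p.2)) (S : Set I) :
    Integrable (fun y => ∫ x in S, k x y) := by
  have h := (integrable_prod_restrict hk S Set.univ).integral_prod_right
  rwa [Measure.restrict_univ] at h

theorem setIntegral_prod_symm (hk : Integrable (fun p : I × I => k p.1 p.2)) (S T : Set I) :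
    ∫ p in S ×ˢ T, k p.1 p.2 = ∫ y in T, ∫ x in S, k x y := by
  rw [Measure.volume_eq_prod, ← Measure.prod_restrict,
    integral_prod_symm _ (integrable_prod_restrict hk S T)]

theorem integral_abs_setIntegral_fst_le (hk : Integrable (fun p : I × I => k p.1 p.2))
    {S : Set I} (hS : MeasurableSet S) : ∫ y, |∫ x in S, k x y| ≤ 2 * cutNorm k := by
  refine integral_abs_le_of_forall_setIntegral (integrable_setIntegral_fst hk S) fun T hT => ?_
  rw [← setIntegral_prod_symm hk]
  exact abs_setIntegral_le_cutNorm hk hS hT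

theorem integrable_mul_snd (hk : Integrable (fun p : I × I => k p.1 p.2)) {g : I → ℝ}
    (hg : AEStronglyMeasurable g volume) {c : ℝ} (hgc : ∀ᵐ y, |g y| ≤ c) :
    Integrable (fun p : I × I => k p.1 p.2 * g p.2) := by
  rw [Measure.volume_eq_prod] at hk ⊢
  exact hk.mul_bdd hg.comp_snd (Measure.quasiMeasurePreserving_snd.ae hgc)

/-- The cut norm controls the action of a kernel on bounded functions. -/
theorem setIntegral_abs_graphonOp_le (hk : Integrable (fun p : I × I => k p.1 p.2)) {g : I → ℝ}
    (hg : AEStronglyMeasurable g volume) {c : ℝ} (hgc : ∀ᵐ y, |g y| ≤ c)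
    {C : Set I} (hC : MeasurableSet C) :
    ∫ x in C, |graphonOp k g x| ≤ 4 * c * cutNorm k := by
  have hkg := integrable_mul_snd hk hg hgc
  have hi : Integrable (graphonOp k g) := by
    rw [Measure.volume_eq_prod] at hkg
    exact hkg.integral_prod_left
  have hc0 : 0 ≤ c := by
    obtain ⟨y, hy⟩ := hgc.exists
    exact (abs_nonneg _).trans hy
  -- The L¹ norm is recovered from set integrals twice, in `y` here and in `x` at the end, at the
  -- price of a factor 2 each time; this is the 4 of the statement.
  have key : ∀ S, MeasurableSet S → |∫ x in S, graphonOp k g x| ≤ c * (2 * cutNorm k) := by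
    intro S hS
    have h1 : ∫ x in S, graphonOp k g x = ∫ y, (∫ x in S, k x y) * g y := by
      have h := integral_integral_swap (f := fun x y => k x y * g y)
        (integrable_prod_restrict (k := fun x y => k x y * g y) hkg S Set.univ)
      rw [Measure.restrict_univ] at h
      simp only [integral_mul_const] at h
      exact h
    rw [h1]
    have hi2 := integrable_setIntegral_fst hk S
    refine abs_integral_le_integral_abs.trans ?_
    refine le_trans ?_ (mul_le_mul_of_nonneg_left (integral_abs_setIntegral_fst_le hk hS) hc0)
    rw [← integral_const_mul]
    refine integral_mono_ae (hi2.mul_bdd hg hgc).abs (hi2.abs.const_mul c) ?_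
    filter_upwards [hgc] with y hy
    rw [abs_mul, mul_comm]
    exact mul_le_mul_of_nonneg_right hy (abs_nonneg _)
  refine (integral_abs_le_of_forall_setIntegral hi.restrict (m := c * (2 * cutNorm k))
    fun T hT => ?_).trans (le_of_eq (by ring))
  rw [Measure.restrict_restrict hT]
  exact key _ (hT.inter hC)

end CutNorm

/-! ### Comparison of the matrix with the cell averages of the graphon -/

section Discretization

variable {N : ℕ}

/-- The average of a kernel over the square of the players `i` and `j`. -/
noncomputable def squareAverage (N : ℕ) (w : I → I → ℝ) (i j : Fin N) : ℝ :=
  (N : ℝ) ^ 2 * ∫ p in cell N i ×ˢ cell N j, w p.1 p.2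

theorem IsGraphon.memLp {w : I → I → ℝ} (hw : IsGraphon w) :
    MemLp (fun p : I × I => w p.1 p.2) 2 volume :=
  (memLp_two_iff_integrable_sq hw.measurable.aestronglyMeasurable).2 hw.sq_integrable

theorem IsGraphon.integrable {w : I → I → ℝ} (hw : IsGraphon w) :
    Integrable (fun p : I × I => w p.1 p.2) volume :=
  hw.memLp.integrable (by norm_num)

theorem integrable_stepGraphon_sub {w : I → I → ℝ} (hw : IsGraphon w)
    (W : Matrix (Fin N) (Fin N) ℝ) :
    Integrable (fun p : I × I => stepGraphon W p.1 p.2 - w p.1 p.2) volume :=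
  ((memLp_stepGraphon W 2).integrable (by norm_num)).sub hw.integrable

theorem sub_squareAverage_eq {w : I → I → ℝ} (hw : IsGraphon w) (W : Matrix (Fin N) (Fin N) ℝ)
    (i j : Fin N) :
    W i j - squareAverage N w i j =
      (N : ℝ) ^ 2 * ∫ p in cell N i ×ˢ cell N j, (stepGraphon W p.1 p.2 - w p.1 p.2) := by
  have hN := (natCast_pos_of_fin i).ne'
  have h := setIntegral_prod_cell W id i j
  simp only [id] at h
  rw [integral_sub ((memLp_stepGraphon W 2).integrable (by norm_num)).integrableOn
    hw.integrable.integrableOn, h, squareAverage]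
  field_simp

theorem abs_sub_squareAverage_le {w : I → I → ℝ} (hw : IsGraphon w)
    (W : Matrix (Fin N) (Fin N) ℝ) (i j : Fin N) :
    |W i j - squareAverage N w i j| ≤ (N : ℝ) ^ 2 * cutDist (stepGraphon W) w := by
  rw [sub_squareAverage_eq hw, abs_mul, abs_of_nonneg (by positivity : (0 : ℝ) ≤ (N : ℝ) ^ 2)]
  exact mul_le_mul_of_nonneg_left (abs_setIntegral_le_cutNorm
    (k := fun x y => stepGraphon W x y - w x y) (integrable_stepGraphon_sub hw W)
    (measurableSet_cell i) (measurableSet_cell j)) (by positivity)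

/-- Summing the entrywise bound would lose a factor `N`. Instead the whole row is dominated by the
L¹ norm in `y` of the kernel difference integrated over cell `i`. -/
theorem sum_abs_sub_squareAverage_le {w : I → I → ℝ} (hw : IsGraphon w)
    (W : Matrix (Fin N) (Fin N) ℝ) (i : Fin N) :
    ∑ j, |W i j - squareAverage N w i j| ≤
      (N : ℝ) ^ 2 * (2 * cutDist (stepGraphon W) w) := by
  have hk := integrable_stepGraphon_sub hw W
  have hN : 1 ≤ N := (Nat.zero_le _).trans_lt i.2
  have h1 := integral_abs_setIntegral_fst_le (k := fun x y => stepGraphon W x y - w x y) hk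
    (measurableSet_cell i)
  refine le_trans ?_ (mul_le_mul_of_nonneg_left h1 (by positivity))
  have hi := integrable_setIntegral_fst (k := fun x y => stepGraphon W x y - w x y) hk (cell N i)
  rw [← sum_setIntegral_cell hN hi.abs, Finset.mul_sum]
  refine Finset.sum_le_sum fun j _ => ?_
  rw [sub_squareAverage_eq hw, abs_mul, abs_of_nonneg (by positivity : (0 : ℝ) ≤ (N : ℝ) ^ 2),
    setIntegral_prod_symm (k := fun x y => stepGraphon W x y - w x y) hk]
  exact mul_le_mul_of_nonneg_left abs_integral_le_integral_abs (by positivity)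

/-- Cauchy–Schwarz on each square, then the row bound integrated over a cell of length `1 / N`. -/
theorem sum_squareAverage_sq_le {w : I → I → ℝ} (hw : IsGraphon w) {ζ : ℝ}
    (hrow : ∀ x, ∫ y, w x y ^ 2 ≤ ζ ^ 2) (i : Fin N) :
    ∑ j, squareAverage N w i j ^ 2 ≤ N * ζ ^ 2 := by
  have hN : 1 ≤ N := (Nat.zero_le _).trans_lt i.2
  have hN0 := natCast_pos_of_fin i
  have hsq : Integrable (fun p : I × I => w p.1 p.2 ^ 2) volume := hw.sq_integrable
  have hj : ∀ j, squareAverage N w i j ^ 2 ≤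
      (N : ℝ) ^ 2 * ∫ y in cell N j, ∫ x in cell N i, w x y ^ 2 := by
    intro j
    have h := sq_integral_le (μ := volume.restrict (cell N i ×ˢ cell N j)) (hw.memLp.restrict _)
    rw [measureReal_restrict_apply MeasurableSet.univ, Set.univ_inter, Measure.volume_eq_prod,
      measureReal_prod_prod, volume_real_cell, volume_real_cell, ← Measure.volume_eq_prod,
      setIntegral_prod_symm (k := fun x y => w x y ^ 2) hsq] at h
    rw [squareAverage, mul_pow]
    refine (mul_le_mul_of_nonneg_left h (by positivity)).trans (le_of_eq ?_)
    field_simp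
  refine (Finset.sum_le_sum fun j _ => hj j).trans ?_
  rw [← Finset.mul_sum, sum_setIntegral_cell hN
    (integrable_setIntegral_fst (k := fun x y => w x y ^ 2) hsq (cell N i))]
  have h2 : ∫ y, ∫ x in cell N i, w x y ^ 2 = ∫ x in cell N i, ∫ y, w x y ^ 2 := by
    have h := integral_integral_swap (f := fun x y => w x y ^ 2)
      (integrable_prod_restrict (k := fun x y => w x y ^ 2) hsq (cell N i) Set.univ)
    rw [Measure.restrict_univ] at h
    exact h.symm
  have h3 : ∫ x in cell N i, ∫ y, w x y ^ 2 ≤ ∫ _ in cell N i, ζ ^ 2 := by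
    refine integral_mono ?_ (integrable_const _) hrow
    rw [Measure.volume_eq_prod] at hsq
    exact hsq.integral_prod_left.restrict
  rw [setIntegral_const, volume_real_cell, smul_eq_mul] at h3
  rw [h2]
  refine (mul_le_mul_of_nonneg_left h3 (by positivity)).trans (le_of_eq ?_)
  field_simp

end Discretization

/-! ### Continuity and measurability of the drift -/

section Drift

variable {A : Set ℝ} {b : ℝ → ℝ → ℝ} {cα cz c₀ : ℝ}

theorem DriftLipschitz.abs_sub_le (hb : DriftLipschitz A b cα cz) {a a' : ℝ} (ha : a ∈ A)
    (ha' : a' ∈ A) (z z' : ℝ) : |b a z - b a' z'| ≤ √cα * |a - a'| + √cz * |z - z'| := by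
  have h := hb.lipschitz a ha a' ha' z z'
  have h1 := Real.sq_sqrt hb.cα_nonneg
  have h2 := Real.sq_sqrt hb.cz_nonneg
  refine abs_le_of_sq_le_sq' ?_ (by positivity) |>.2
  have h3 : 0 ≤ 2 * (√cα * |a - a'|) * (√cz * |z - z'|) := by positivity
  calc |b a z - b a' z'| ^ 2 ≤ √cα ^ 2 * |a - a'| ^ 2 + √cz ^ 2 * |z - z'| ^ 2 := by
        rw [h1, h2]; exact h
    _ ≤ _ := by nlinarith

theorem DriftLipschitz.continuousOn (hb : DriftLipschitz A b cα cz) :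
    ContinuousOn (Function.uncurry b) (A ×ˢ Set.univ) := by
  rintro ⟨a, z⟩ ⟨ha, -⟩
  rw [ContinuousWithinAt, tendsto_iff_dist_tendsto_zero]
  have hlim : Tendsto (fun p : ℝ × ℝ => √cα * |p.1 - a| + √cz * |p.2 - z|)
      (𝓝[A ×ˢ Set.univ] (a, z)) (𝓝 0) := by
    have hc : Continuous (fun p : ℝ × ℝ => √cα * |p.1 - a| + √cz * |p.2 - z|) := by fun_prop
    have := hc.tendsto (a, z)
    simp only [sub_self, abs_zero, mul_zero, add_zero] at this
    exact this.mono_left nhdsWithin_le_nhds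
  refine squeeze_zero' (Eventually.of_forall fun _ => dist_nonneg) ?_ hlim
  filter_upwards [self_mem_nhdsWithin] with p hp
  exact hb.abs_sub_le hp.1 ha _ _

/-- The drift is controlled only on `A × ℝ`. As `A` is an interval, hence Borel, extending by zero
gives a measurable function that agrees almost everywhere along `u`. -/
theorem DriftLipschitz.aestronglyMeasurable_comp (hb : DriftLipschitz A b cα cz)
    (hA : Convex ℝ A) {X : Type*} [MeasurableSpace X] {μ : Measure X} {u z : X → ℝ}
    (hu : AEMeasurable u μ) (hz : AEMeasurable z μ) (huA : ∀ᵐ x ∂μ, u x ∈ A) :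
    AEStronglyMeasurable (fun x => b (u x) (z x)) μ := by
  classical
  have hAm : MeasurableSet (A ×ˢ (Set.univ : Set ℝ)) :=
    hA.ordConnected.measurableSet.prod MeasurableSet.univ
  have hF : Measurable ((A ×ˢ (Set.univ : Set ℝ)).piecewise (Function.uncurry b) fun _ => 0) :=
    hb.continuousOn.measurable_piecewise continuousOn_const hAm
  refine (hF.comp_aemeasurable (hu.prodMk hz)).aestronglyMeasurable.congr ?_
  filter_upwards [huA] with x hx
  exact Set.piecewise_eq_of_mem (A ×ˢ (Set.univ : Set ℝ)) _ _ (Set.mk_mem_prod hx (Set.mem_univ _))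

theorem memLp_drift (hb : DriftLipschitz A b cα cz) (hbb : DriftBounded A b c₀)
    (hA : Convex ℝ A) {X : Type*} [MeasurableSpace X] {μ : Measure X} [IsFiniteMeasure μ]
    {u z : X → ℝ} (hu : AEMeasurable u μ) (hz : AEMeasurable z μ) (huA : ∀ᵐ x ∂μ, u x ∈ A)
    (p : ℝ≥0∞) : MemLp (fun x => b (u x) (z x)) p μ :=
  MemLp.of_bound (hb.aestronglyMeasurable_comp hA hu hz huA) c₀
    (huA.mono fun _ hx => hbb.bound _ hx _)

end Drift

/-! ### Graphon operators and the aggregate of the graphon game -/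

section Aggregate

variable {w : I → I → ℝ}

theorem aestronglyMeasurable_graphonOp (hw : IsGraphon w) {h : I → ℝ}
    (hh : AEStronglyMeasurable h volume) : AEStronglyMeasurable (graphonOp w h) volume := by
  have h1 : AEStronglyMeasurable (fun p : I × I => w p.1 p.2 * h p.2)
      ((volume : Measure I).prod volume) :=
    hw.measurable.aestronglyMeasurable.mul hh.comp_snd
  exact h1.integral_prod_right'

theorem graphonOp_sq_le {h : I → ℝ} (hh : MemLp h 2 volume) {x : I} (hx : MemLp (w x) 2 volume) :
    graphonOp w h x ^ 2 ≤ (∫ y, w x y ^ 2) * ∫ y, h y ^ 2 :=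
  sq_integral_mul_le hx hh

theorem IsGraphon.integrable_row_sq (hw : IsGraphon w) : Integrable (fun x => ∫ y, w x y ^ 2) := by
  have h := hw.sq_integrable
  rw [Measure.volume_eq_prod] at h
  exact h.integral_prod_left

theorem memLp_graphonOp (hw : IsGraphon w) (hrow : ∀ x, MemLp (w x) 2 volume) {h : I → ℝ}
    (hh : MemLp h 2 volume) : MemLp (graphonOp w h) 2 volume := by
  have hm := aestronglyMeasurable_graphonOp hw hh.aestronglyMeasurable
  rw [memLp_two_iff_integrable_sq hm]
  refine (hw.integrable_row_sq.mul_const (∫ y, h y ^ 2)).mono' (hm.pow 2)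
    (ae_of_all _ fun x => ?_)
  rw [Real.norm_of_nonneg (sq_nonneg _)]
  exact graphonOp_sq_le hh (hrow x)

theorem l2Norm_sq (w : I → I → ℝ) : l2Norm w ^ 2 = ∫ p : I × I, w p.1 p.2 ^ 2 :=
  Real.sq_sqrt (integral_nonneg fun _ => sq_nonneg _)

/-- The operator of a graphon is bounded by its Hilbert–Schmidt norm. -/
theorem integral_graphonOp_sq_le (hw : IsGraphon w) (hrow : ∀ x, MemLp (w x) 2 volume) {h : I → ℝ}
    (hh : MemLp h 2 volume) :
    ∫ x, graphonOp w h x ^ 2 ≤ l2Norm w ^ 2 * ∫ y, h y ^ 2 := by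
  have h1 := integral_mono (memLp_graphonOp hw hrow hh).integrable_sq
    (hw.integrable_row_sq.mul_const (∫ y, h y ^ 2)) fun x => graphonOp_sq_le hh (hrow x)
  refine h1.trans (le_of_eq ?_)
  have h2 := hw.sq_integrable
  rw [l2Norm_sq, integral_mul_const]
  rw [Measure.volume_eq_prod] at h2 ⊢
  rw [integral_prod _ h2]

theorem graphonOp_sub {g h : I → ℝ} (hg : MemLp g 2 volume) (hh : MemLp h 2 volume) {x : I}
    (hx : MemLp (w x) 2 volume) :
    graphonOp w (fun y => g y - h y) x = graphonOp w g x - graphonOp w h x := by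
  have h := integral_sub (hx.integrable_mul hg) (hx.integrable_mul hh)
  simp only [Pi.mul_apply, ← mul_sub] at h
  exact h

/-- A contraction in the Hilbert–Schmidt norm has an aggregate at every admissible profile. -/
theorem exists_isAggregate {A : Set ℝ} {b : ℝ → ℝ → ℝ} {cα cz c₀ : ℝ} (hA : Convex ℝ A)
    (hb : DriftLipschitz A b cα cz) (hbb : DriftBounded A b c₀) (hw : IsGraphon w)
    (hrow : ∀ x, MemLp (w x) 2 volume) (hcon : √cz * l2Norm w < 1) {α : L2I}
    (hα : IsAdmissible A α) : ∃ z, IsAggregate w b α z := by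
  have hαm : AEMeasurable α volume := (Lp.aestronglyMeasurable α).aemeasurable
  have hmem : ∀ z : L2I, MemLp (fun y => b (α y) (z y)) 2 volume := fun z =>
    memLp_drift hb hbb hA hαm (Lp.aestronglyMeasurable z).aemeasurable hα 2
  let T : L2I → L2I := fun z => (memLp_graphonOp hw hrow (hmem z)).toLp _
  have hl0 : 0 ≤ √cz * l2Norm w := mul_nonneg (Real.sqrt_nonneg _) (Real.sqrt_nonneg _)
  have hT : ContractingWith (Real.toNNReal (√cz * l2Norm w)) T := by
    refine ⟨by rwa [Real.toNNReal_lt_one], LipschitzWith.of_dist_le_mul fun z z' => ?_⟩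
    rw [Real.coe_toNNReal _ hl0, dist_eq_norm, dist_eq_norm, ← MemLp.toLp_sub]
    refine abs_le_of_sq_le_sq' ?_ (by positivity) |>.2
    rw [norm_toLp_sq_eq_integral]
    have hd := (hmem z).sub (hmem z')
    have h1 := integral_graphonOp_sq_le hw hrow hd
    have h2 : ∫ x, (graphonOp w (fun y => b (α y) (z y)) -
        graphonOp w fun y => b (α y) (z' y)) x ^ 2 =
        ∫ x, graphonOp w (fun y => b (α y) (z y) - b (α y) (z' y)) x ^ 2 := by
      refine integral_congr_ae (ae_of_all _ fun x => ?_)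
      simp only [Pi.sub_apply, graphonOp_sub (hmem z) (hmem z') (hrow x)]
    rw [h2]
    refine h1.trans ?_
    have h3 : ∫ y, (b (α y) (z y) - b (α y) (z' y)) ^ 2 ≤ cz * ‖z - z'‖ ^ 2 := by
      rw [norm_lp_sq_eq_integral, ← integral_const_mul]
      refine integral_mono_ae hd.integrable_sq
        ((Lp.memLp (z - z')).integrable_sq.const_mul cz) ?_
      filter_upwards [hα, Lp.coeFn_sub z z'] with y hy hs
      have := hb.lipschitz _ hy _ hy (z y) (z' y)
      rw [hs]
      simpa using this
    refine (mul_le_mul_of_nonneg_left h3 (sq_nonneg _)).trans (le_of_eq ?_)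
    rw [mul_pow, mul_pow, Real.sq_sqrt hb.cz_nonneg]
    ring
  refine ⟨hT.fixedPoint T, ?_⟩
  have hfix : T (hT.fixedPoint T) = hT.fixedPoint T := hT.fixedPoint_isFixedPt
  have hco := (memLp_graphonOp hw hrow (hmem (hT.fixedPoint T))).coeFn_toLp
  unfold IsAggregate
  conv_lhs => rw [← hfix]
  exact hco

end Aggregate

/-! ### Well-posedness of the finite game -/

section PlayerAggregate

variable {A : Set ℝ} {b : ℝ → ℝ → ℝ} {cα cz c₀ : ℝ} {N : ℕ}
  {Ω : Type*} [MeasurableSpace Ω] {P : Measure Ω}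

theorem frobNorm_sq (W : Matrix (Fin N) (Fin N) ℝ) :
    frobNorm W ^ 2 = (1 / (N : ℝ) ^ 2) * ∑ i, ∑ j, W i j ^ 2 :=
  Real.sq_sqrt (mul_nonneg (by positivity)
    (Finset.sum_nonneg fun i _ => Finset.sum_nonneg fun j _ => sq_nonneg _))

/-- A matrix is bounded by its Frobenius norm. -/
theorem sum_sq_mul_sum_le (W : Matrix (Fin N) (Fin N) ℝ) (u : Fin N → ℝ) :
    ∑ i, ((1 / (N : ℝ)) * ∑ j, |W i j| * u j) ^ 2 ≤ frobNorm W ^ 2 * ∑ j, u j ^ 2 := by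
  rw [frobNorm_sq, mul_assoc, Finset.sum_mul, Finset.mul_sum]
  refine Finset.sum_le_sum fun i _ => ?_
  rw [mul_pow, one_div_pow]
  refine mul_le_mul_of_nonneg_left ?_ (by positivity)
  simpa using Finset.sum_mul_sq_le_sq_mul_sq Finset.univ (fun j => |W i j|) u

theorem norm_smul_sum_le {E : Type*} [NormedAddCommGroup E] [NormedSpace ℝ E]
    (W : Matrix (Fin N) (Fin N) ℝ) (u : Fin N → E) (i : Fin N) :
    ‖(1 / (N : ℝ)) • ∑ j, W i j • u j‖ ≤ (1 / (N : ℝ)) * ∑ j, |W i j| * ‖u j‖ := by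
  rw [norm_smul, Real.norm_of_nonneg (by positivity)]
  refine mul_le_mul_of_nonneg_left ?_ (by positivity)
  refine (norm_sum_le _ _).trans (le_of_eq (Finset.sum_congr rfl fun j _ => ?_))
  rw [norm_smul, Real.norm_eq_abs]

theorem coeFn_smul_sum (W : Matrix (Fin N) (Fin N) ℝ) (u v : Fin N → Lp ℝ 2 P) (i : Fin N) :
    ⇑((1 / (N : ℝ)) • ∑ j, W i j • (u j + v j)) =ᵐ[P]
      fun ω => (1 / (N : ℝ)) * ∑ j, W i j * (u j ω + v j ω) := by
  have h1 : ∀ᵐ ω ∂P, ∀ j, (W i j • (u j + v j)) ω = W i j * (u j ω + v j ω) := by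
    rw [ae_all_iff]
    intro j
    filter_upwards [Lp.coeFn_smul (W i j) (u j + v j), Lp.coeFn_add (u j) (v j)] with ω h h'
    rw [h, Pi.smul_apply, h', smul_eq_mul, Pi.add_apply]
  filter_upwards [Lp.coeFn_smul (1 / (N : ℝ)) (∑ j, W i j • (u j + v j)),
    Lp.coeFn_finsetSum (s := Finset.univ) (f := fun j => W i j • (u j + v j)), h1] with ω h h' h''
  rw [h, Pi.smul_apply, h', smul_eq_mul, Finset.sum_apply]
  simp only [h'']

variable [IsProbabilityMeasure P]

theorem memLp_drift_const (hb : DriftLipschitz A b cα cz) (hbb : DriftBounded A b c₀)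
    (hA : Convex ℝ A) {a : ℝ} (ha : a ∈ A) (z : Lp ℝ 2 P) :
    MemLp (fun ω => b a (z ω)) 2 P :=
  memLp_drift hb hbb hA aemeasurable_const (Lp.aestronglyMeasurable z).aemeasurable
    (ae_of_all _ fun _ => ha) 2

theorem norm_toLp_drift_sub_le (hb : DriftLipschitz A b cα cz) (hbb : DriftBounded A b c₀)
    (hA : Convex ℝ A) {a : ℝ} (ha : a ∈ A) (z z' : Lp ℝ 2 P) :
    ‖(memLp_drift_const hb hbb hA ha z).toLp - (memLp_drift_const hb hbb hA ha z').toLp‖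
      ≤ √cz * ‖z - z'‖ := by
  rw [← MemLp.toLp_sub]
  refine Lp.norm_le_mul_norm_of_ae_le_mul ?_
  filter_upwards [((memLp_drift_const hb hbb hA ha z).sub
    (memLp_drift_const hb hbb hA ha z')).coeFn_toLp, Lp.coeFn_sub z z'] with ω h1 h2
  rw [h1, h2]
  simpa using hb.abs_sub_le ha ha (z ω) (z' ω)

theorem isPlayerAggregate_iff (hb : DriftLipschitz A b cα cz) (hbb : DriftBounded A b c₀)
    (hA : Convex ℝ A) (W : Matrix (Fin N) (Fin N) ℝ) {ξ : Fin N → Ω → ℝ}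
    (hξ : ∀ i, MemLp (ξ i) 2 P) {a : Fin N → ℝ} (ha : ∀ i, a i ∈ A) (z : Fin N → Lp ℝ 2 P) :
    IsPlayerAggregate P W b ξ a z ↔ ∀ i, z i = (1 / (N : ℝ)) • ∑ j, W i j •
      ((memLp_drift_const hb hbb hA (ha j) (z j)).toLp + (hξ j).toLp) := by
  refine forall_congr' fun i => ?_
  have h1 := coeFn_smul_sum (P := P) W
    (fun j => (memLp_drift_const hb hbb hA (ha j) (z j)).toLp) (fun j => (hξ j).toLp) i
  have h2 : ∀ᵐ ω ∂P, ∀ j, (memLp_drift_const hb hbb hA (ha j) (z j)).toLp _ ω = b (a j) (z j ω) ∧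
      (hξ j).toLp _ ω = ξ j ω := by
    rw [ae_all_iff]
    exact fun j => (MemLp.coeFn_toLp _).and (MemLp.coeFn_toLp _)
  have h3 : ⇑((1 / (N : ℝ)) • ∑ j, W i j •
      ((memLp_drift_const hb hbb hA (ha j) (z j)).toLp + (hξ j).toLp)) =ᵐ[P]
      fun ω => (1 / (N : ℝ)) * ∑ j, W i j * (b (a j) (z j ω) + ξ j ω) := by
    filter_upwards [h1, h2] with ω h h'
    rw [h]
    simp only [(h' _).1, (h' _).2]
  rw [Lp.ext_iff]
  exact ⟨fun h => h.trans h3.symm, fun h => h.trans h3⟩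

/-- Banach's fixed point theorem in the ℓ² product of `N` copies of `L²(P)`; this product norm is
what makes the Frobenius norm appear. The noises cancel in differences. -/
theorem playerAggregateWellDefined (hb : DriftLipschitz A b cα cz) (hbb : DriftBounded A b c₀)
    (hA : Convex ℝ A) (W : Matrix (Fin N) (Fin N) ℝ) {ξ : Fin N → Ω → ℝ}
    (hξ : ∀ i, MemLp (ξ i) 2 P) (hcon : √cz * frobNorm W < 1) :
    PlayerAggregateWellDefined P A W b ξ := by
  intro a ha
  let T : PiLp 2 (fun _ : Fin N => Lp ℝ 2 P) → PiLp 2 (fun _ : Fin N => Lp ℝ 2 P) := fun z =>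
    WithLp.toLp 2 fun i => (1 / (N : ℝ)) • ∑ j, W i j •
      ((memLp_drift_const hb hbb hA (ha j) (z j)).toLp + (hξ j).toLp)
  have hl0 : 0 ≤ √cz * frobNorm W := mul_nonneg (Real.sqrt_nonneg _) (Real.sqrt_nonneg _)
  have hT : ContractingWith (Real.toNNReal (√cz * frobNorm W)) T := by
    refine ⟨by rwa [Real.toNNReal_lt_one], LipschitzWith.of_dist_le_mul fun z z' => ?_⟩
    rw [Real.coe_toNNReal _ hl0, dist_eq_norm, dist_eq_norm]
    refine abs_le_of_sq_le_sq' ?_ (by positivity) |>.2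
    rw [mul_pow, mul_pow, PiLp.norm_sq_eq_of_L2, PiLp.norm_sq_eq_of_L2]
    have h1 : ∀ i, ‖(T z - T z') i‖ ≤ (1 / (N : ℝ)) * ∑ j, |W i j| * (√cz * ‖z j - z' j‖) := by
      intro i
      have h2 : (T z - T z') i = (1 / (N : ℝ)) • ∑ j, W i j •
          ((memLp_drift_const hb hbb hA (ha j) (z j)).toLp -
            (memLp_drift_const hb hbb hA (ha j) (z' j)).toLp) := by
        simp only [T, PiLp.sub_apply]
        rw [← smul_sub, ← Finset.sum_sub_distrib]
        simp only [← smul_sub, add_sub_add_right_eq_sub]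
      rw [h2]
      refine (norm_smul_sum_le W _ i).trans ?_
      refine mul_le_mul_of_nonneg_left (Finset.sum_le_sum fun j _ => ?_) (by positivity)
      exact mul_le_mul_of_nonneg_left (norm_toLp_drift_sub_le hb hbb hA (ha j) _ _) (abs_nonneg _)
    calc ∑ i, ‖(T z - T z') i‖ ^ 2
        ≤ ∑ i, ((1 / (N : ℝ)) * ∑ j, |W i j| * (√cz * ‖z j - z' j‖)) ^ 2 :=
          Finset.sum_le_sum fun i _ => pow_le_pow_left₀ (norm_nonneg _) (h1 i) 2
      _ ≤ frobNorm W ^ 2 * ∑ j, (√cz * ‖z j - z' j‖) ^ 2 := sum_sq_mul_sum_le W _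
      _ = _ := by
          simp only [mul_pow, ← Finset.mul_sum, PiLp.sub_apply]
          ring
  have hiff : ∀ z : PiLp 2 (fun _ : Fin N => Lp ℝ 2 P),
      IsPlayerAggregate P W b ξ a z.ofLp ↔ T z = z := by
    intro z
    rw [isPlayerAggregate_iff hb hbb hA W hξ ha]
    constructor
    · intro h
      ext1 i
      exact (h i).symm
    · intro h i
      exact congrArg (fun y : PiLp 2 (fun _ : Fin N => Lp ℝ 2 P) => y i) h.symm
  refine ⟨(hT.fixedPoint T).ofLp, (hiff _).2 hT.fixedPoint_isFixedPt, fun z hz => ?_⟩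
  have := hT.fixedPoint_unique ((hiff (WithLp.toLp 2 z)).1 hz)
  rw [← this]

end PlayerAggregate

/-! ### Minkowski inequalities and contracting systems -/

section FiniteSums

theorem sqrt_sum_sq_le_add {ι : Type*} [Fintype ι] {x y z : ι → ℝ} (hx : ∀ i, 0 ≤ x i)
    (h : ∀ i, x i ≤ y i + z i) :
    √(∑ i, x i ^ 2) ≤ √(∑ i, y i ^ 2) + √(∑ i, z i ^ 2) := by
  have h1 : √(∑ i, x i ^ 2) ≤ √(∑ i, (y i + z i) ^ 2) :=
    Real.sqrt_le_sqrt (Finset.sum_le_sum fun i _ => pow_le_pow_left₀ (hx i) (h i) 2)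
  refine h1.trans ?_
  have h2 := norm_add_le (WithLp.toLp 2 y : EuclideanSpace ℝ ι) (WithLp.toLp 2 z)
  simpa [EuclideanSpace.norm_eq] using h2

theorem sqrt_sum_const_mul_sq {ι : Type*} [Fintype ι] {c : ℝ} (hc : 0 ≤ c) (x : ι → ℝ) :
    √(∑ i, (c * x i) ^ 2) = c * √(∑ i, x i ^ 2) := by
  simp only [mul_pow, ← Finset.mul_sum]
  rw [Real.sqrt_mul (sq_nonneg c), Real.sqrt_sq hc]

theorem sum_mul_le_sqrt_mul_sqrt_abs {ι : Type*} [Fintype ι] (x y : ι → ℝ) :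
    ∑ i, |x i| * y i ≤ √(∑ i, x i ^ 2) * √(∑ i, y i ^ 2) := by
  simpa using Real.sum_mul_le_sqrt_mul_sqrt Finset.univ (fun i => |x i|) y

variable {N : ℕ}

/-- Stability of a system of inequalities that is contracting in the Frobenius norm. -/
theorem sqrt_sum_sq_le_of_contracting {W : Matrix (Fin N) (Fin N) ℝ} {q : ℝ} (hq : 0 ≤ q)
    (hcon : q * frobNorm W < 1) {t u n s : Fin N → ℝ} (ht0 : ∀ i, 0 ≤ t i) (hu0 : ∀ i, 0 ≤ u i)
    (ht : ∀ i, t i ≤ (1 / (N : ℝ)) * ∑ j, |W i j| * u j + n i)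
    (hu : ∀ i, u i ≤ q * t i + s i) :
    √(∑ i, u i ^ 2) ≤ (q * √(∑ i, n i ^ 2) + √(∑ i, s i ^ 2)) / (1 - q * frobNorm W) := by
  have hF : 0 ≤ frobNorm W := Real.sqrt_nonneg _
  -- In ℓ² norms the hypotheses read `U ≤ q T + S` and `T ≤ ‖W‖_F U + n`; eliminating `T` gives the
  -- claim.
  have h1 := sqrt_sum_sq_le_add hu0 hu
  rw [sqrt_sum_const_mul_sq hq] at h1
  have h2 := sqrt_sum_sq_le_add ht0 ht
  have h3 : √(∑ i, ((1 / (N : ℝ)) * ∑ j, |W i j| * u j) ^ 2) ≤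
      frobNorm W * √(∑ i, u i ^ 2) := by
    refine (Real.sqrt_le_sqrt (sum_sq_mul_sum_le W u)).trans (le_of_eq ?_)
    rw [Real.sqrt_mul (sq_nonneg _), Real.sqrt_sq hF]
  rw [le_div_iff₀ (by linarith)]
  have h4 := mul_le_mul_of_nonneg_left (h2.trans (add_le_add_left h3 _)) hq
  linarith

end FiniteSums

/-! ### Estimates for single rows of the matrix -/

section Rows

variable {N : ℕ} {w : I → I → ℝ} {W : Matrix (Fin N) (Fin N) ℝ} {ζ γ : ℝ}

theorem sqrt_sum_squareAverage_sq_le (hw : IsGraphon w) (hζ : 0 ≤ ζ)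
    (hrow : ∀ x, ∫ y, w x y ^ 2 ≤ ζ ^ 2) (i : Fin N) :
    √(∑ j, squareAverage N w i j ^ 2) ≤ √N * ζ := by
  refine (Real.sqrt_le_sqrt (sum_squareAverage_sq_le hw hrow i)).trans (le_of_eq ?_)
  rw [Real.sqrt_mul (Nat.cast_nonneg N), Real.sqrt_sq hζ]

/-- Passes from an average over players to one player. The difference between `W` and the square
averages is small in row sum and meets the uniform bound `c`; the averages have bounded row square
sums and meet the ℓ² norm of `u` by Cauchy–Schwarz. -/
theorem row_mul_le (hw : IsGraphon w) (hζ : 0 ≤ ζ) (hrow : ∀ x, ∫ y, w x y ^ 2 ≤ ζ ^ 2)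
    (hcut : cutDist (stepGraphon W) w ≤ γ) {u : Fin N → ℝ} {c : ℝ} (hu0 : ∀ j, 0 ≤ u j)
    (huc : ∀ j, u j ≤ c) (i : Fin N) :
    (1 / (N : ℝ)) * ∑ j, |W i j| * u j ≤
      2 * c * (N * γ) + ζ * ((1 / √N) * √(∑ j, u j ^ 2)) := by
  have hN := natCast_pos_of_fin i
  have hc : 0 ≤ c := (hu0 i).trans (huc i)
  have h1 : ∑ j, |W i j| * u j ≤ ∑ j, (|W i j - squareAverage N w i j| * c +
      |squareAverage N w i j| * u j) := by
    refine Finset.sum_le_sum fun j _ => ?_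
    have h2 : |W i j| ≤ |W i j - squareAverage N w i j| + |squareAverage N w i j| := by
      simpa using abs_add_le (W i j - squareAverage N w i j) (squareAverage N w i j)
    have h3 := mul_le_mul_of_nonneg_right h2 (hu0 j)
    have h4 := mul_le_mul_of_nonneg_left (huc j) (abs_nonneg (W i j - squareAverage N w i j))
    linarith
  rw [Finset.sum_add_distrib, ← Finset.sum_mul] at h1
  have h5 := mul_le_mul_of_nonneg_right (sum_abs_sub_squareAverage_le hw W i) hc
  have h6 : (N : ℝ) ^ 2 * (2 * cutDist (stepGraphon W) w) * c ≤ (N : ℝ) ^ 2 * (2 * γ) * c := by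
    gcongr
  have h7 := (sum_mul_le_sqrt_mul_sqrt_abs (squareAverage N w i) u).trans
    (mul_le_mul_of_nonneg_right (sqrt_sum_squareAverage_sq_le hw hζ hrow i) (Real.sqrt_nonneg _))
  have h8 : (1 / (N : ℝ)) * ∑ j, |W i j| * u j ≤ (1 / (N : ℝ)) *
      ((N : ℝ) ^ 2 * (2 * γ) * c + √N * ζ * √(∑ j, u j ^ 2)) :=
    mul_le_mul_of_nonneg_left (by linarith) (by positivity)
  refine h8.trans (le_of_eq ?_)
  have h9 : (N : ℝ) = √N * √N := (Real.mul_self_sqrt hN.le).symm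
  have h10 : √(N : ℝ) ≠ 0 := (Real.sqrt_pos.2 hN).ne'
  have h11 : (1 / (N : ℝ)) * √N = 1 / √N := by
    nth_rewrite 1 [h9]
    field_simp
  have h12 : (1 / (N : ℝ)) * (N : ℝ) ^ 2 = N := by field_simp
  calc _ = 2 * c * (((1 / (N : ℝ)) * (N : ℝ) ^ 2) * γ) +
        ζ * (((1 / (N : ℝ)) * √N) * √(∑ j, u j ^ 2)) := by ring
    _ = _ := by rw [h11, h12]

theorem row_abs_le (hw : IsGraphon w) (hζ : 0 ≤ ζ) (hrow : ∀ x, ∫ y, w x y ^ 2 ≤ ζ ^ 2)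
    (hcut : cutDist (stepGraphon W) w ≤ γ) (i : Fin N) :
    (1 / (N : ℝ)) * ∑ j, |W i j| ≤ 2 * (N * γ) + ζ := by
  have hN := natCast_pos_of_fin i
  have h := row_mul_le hw hζ hrow hcut (u := fun _ => 1) (fun _ => zero_le_one) (fun _ => le_rfl) i
  have h10 : √(N : ℝ) ≠ 0 := (Real.sqrt_pos.2 hN).ne'
  simpa [h10] using h

theorem entry_abs_le (hw : IsGraphon w) (hζ : 0 ≤ ζ) (hrow : ∀ x, ∫ y, w x y ^ 2 ≤ ζ ^ 2)
    (hcut : cutDist (stepGraphon W) w ≤ γ) (i j : Fin N) :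
    |W i j| ≤ N * (N * γ + ζ * (1 / √N)) := by
  have hN := natCast_pos_of_fin i
  have h1 : |W i j| ≤ |W i j - squareAverage N w i j| + |squareAverage N w i j| := by
    simpa using abs_add_le (W i j - squareAverage N w i j) (squareAverage N w i j)
  have h2 := (abs_sub_squareAverage_le hw W i j).trans
    (mul_le_mul_of_nonneg_left hcut (by positivity))
  have h3 : |squareAverage N w i j| ≤ √N * ζ := by
    refine le_trans ?_ (sqrt_sum_squareAverage_sq_le hw hζ hrow i)
    rw [← Real.sqrt_sq_eq_abs]
    exact Real.sqrt_le_sqrt (Finset.single_le_sum (f := fun j => squareAverage N w i j ^ 2)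
      (fun _ _ => sq_nonneg _) (Finset.mem_univ j))
  have h4 : (N : ℝ) * (1 / √N) = √N := by
    rw [mul_one_div, Real.div_sqrt]
  calc |W i j| ≤ (N : ℝ) ^ 2 * γ + √N * ζ := by linarith
    _ = (N : ℝ) ^ 2 * γ + ((N : ℝ) * (1 / √N)) * ζ := by rw [h4]
    _ = _ := by ring

/-- The square sum of a row is at most its absolute sum times its largest entry. Divided by `N`, the
former stays bounded and the latter vanishes, so the noise felt by each player averages out. -/
theorem row_sq_le (hw : IsGraphon w) (hζ : 0 ≤ ζ) (hrow : ∀ x, ∫ y, w x y ^ 2 ≤ ζ ^ 2)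
    (hγ : 0 ≤ γ) (hcut : cutDist (stepGraphon W) w ≤ γ) (i : Fin N) :
    (1 / (N : ℝ) ^ 2) * ∑ j, W i j ^ 2 ≤ (2 * (N * γ) + ζ) * (N * γ + ζ * (1 / √N)) := by
  have hN := natCast_pos_of_fin i
  have h1 : ∑ j, W i j ^ 2 ≤ (∑ j, |W i j|) * (N * (N * γ + ζ * (1 / √N))) := by
    rw [Finset.sum_mul]
    refine Finset.sum_le_sum fun j _ => ?_
    rw [← sq_abs, sq]
    exact mul_le_mul_of_nonneg_left (entry_abs_le hw hζ hrow hcut i j) (abs_nonneg _)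
  calc _ ≤ (1 / (N : ℝ) ^ 2) * ((∑ j, |W i j|) * (N * (N * γ + ζ * (1 / √N)))) :=
        mul_le_mul_of_nonneg_left h1 (by positivity)
    _ = ((1 / (N : ℝ)) * ∑ j, |W i j|) * (N * γ + ζ * (1 / √N)) := by field_simp
    _ ≤ _ := mul_le_mul_of_nonneg_right (row_abs_le hw hζ hrow hcut i) (by positivity)

end Rows

/-! ### Concentration of each player's aggregate -/

section PlayerEstimate

variable {A : Set ℝ} {b : ℝ → ℝ → ℝ} {cα cz c₀ : ℝ} {N : ℕ} {μ₀ : Measure ℝ}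
  {Ω : Type*} [MeasurableSpace Ω] {P : Measure Ω}

/-- Independent centered noises are orthogonal in L². -/
theorem norm_noise_sq (hμ₀ : NoiseLaw μ₀) {ξ : Fin N → Ω → ℝ} (hlaw : ∀ i, HasLaw (ξ i) μ₀ P)
    (hind : iIndepFun ξ P) (W : Matrix (Fin N) (Fin N) ℝ) (i : Fin N) :
    ‖(1 / (N : ℝ)) • ∑ j, W i j • (hμ₀.memLp_two (hlaw j)).toLp‖ ^ 2 =
      (1 / (N : ℝ) ^ 2) * (∑ j, W i j ^ 2) * ∫ x, x ^ 2 ∂μ₀ := by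
  have hin : ∀ j k, inner ℝ ((hμ₀.memLp_two (hlaw j)).toLp (ξ j))
      ((hμ₀.memLp_two (hlaw k)).toLp (ξ k)) = if j = k then ∫ x, x ^ 2 ∂μ₀ else 0 := by
    intro j k
    split_ifs with hjk
    · subst hjk
      rw [real_inner_self_eq_norm_sq, norm_toLp_sq_eq_integral, ← (hlaw j).map_eq,
        integral_map (hlaw j).aemeasurable (by fun_prop)]
    · have h1 : inner ℝ ((hμ₀.memLp_two (hlaw j)).toLp (ξ j))
          ((hμ₀.memLp_two (hlaw k)).toLp (ξ k)) = ∫ ω, (ξ j * ξ k) ω ∂P := by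
        rw [L2.inner_def]
        refine integral_congr_ae ?_
        filter_upwards [(hμ₀.memLp_two (hlaw j)).coeFn_toLp,
          (hμ₀.memLp_two (hlaw k)).coeFn_toLp] with ω h h'
        simp [h, h', mul_comm]
      have h2 : ∫ ω, ξ j ω ∂P = 0 := by
        rw [← hμ₀.centered, ← (hlaw j).map_eq, integral_map (hlaw j).aemeasurable (by fun_prop)]
      rw [h1, (hind.indepFun hjk).integral_mul_eq_mul_integral
        (hlaw j).aemeasurable.aestronglyMeasurable (hlaw k).aemeasurable.aestronglyMeasurable,
        h2, zero_mul]
  rw [norm_smul, mul_pow, ← real_inner_self_eq_norm_sq (∑ j, W i j • _), sum_inner]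
  simp only [inner_sum, inner_smul_left, inner_smul_right, hin]
  simp [Finset.sum_mul, sq, mul_assoc]

variable [IsProbabilityMeasure P]

theorem norm_lp_le_of_ae_bound {h : Lp ℝ 2 P} {C : ℝ} (hC : 0 ≤ C) (hh : ∀ᵐ ω ∂P, |h ω| ≤ C) :
    ‖h‖ ≤ C := by
  have h1 := Lp.norm_le_of_ae_bound (f := h) hC hh
  have h2 : measureUnivNNReal P = 1 := by simp [measureUnivNNReal]
  simpa [h2] using h1

/-- A bound for the distance between the aggregate of a player and its deterministic limit. -/
noncomputable def aggregateError (cα cz c₀ σ ζ D r η s F : ℝ) : ℝ :=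
  4 * c₀ * η + ζ * ((√cz * (F * σ) * s + √cα * D * s + r) / (1 - √cz * F)) +
    σ * √((2 * η + ζ) * (η + ζ * s))

/-- The profile `a` is only required to be within `D` of `m` in ℓ², so that the equilibrium averages
and all unilateral deviations are covered at once. The contracting system controls the drift errors
on average, and the row estimates then control player `i`. -/
theorem sqrt_integral_playerAggregate_le (hA : Convex ℝ A) (hμ₀ : NoiseLaw μ₀)
    (hb : DriftLipschitz A b cα cz) (hbb : DriftBounded A b c₀)
    {ξ : Fin N → Ω → ℝ} (hlaw : ∀ i, HasLaw (ξ i) μ₀ P) (hind : iIndepFun ξ P)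
    {w : I → I → ℝ} (hw : IsGraphon w) {ζ γ : ℝ} (hζ : 0 ≤ ζ)
    (hrow : ∀ x, ∫ y, w x y ^ 2 ≤ ζ ^ 2) {W : Matrix (Fin N) (Fin N) ℝ} (hγ : 0 ≤ γ)
    (hcut : cutDist (stepGraphon W) w ≤ γ) (hcon : √cz * frobNorm W < 1)
    {c g m a : Fin N → ℝ} {r D : ℝ} (hr : 0 ≤ r) (hD : 0 ≤ D) (ha : ∀ i, a i ∈ A)
    (hg : ∀ i, |g i| ≤ c₀) (hc : ∀ i, c i = (1 / (N : ℝ)) * ∑ j, W i j * g j)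
    (hdrift : ∀ j z, |b (a j) z - g j| ≤ √cz * |z - c j| + (√cα * |a j - m j| + r))
    (hm : ∑ j, (a j - m j) ^ 2 ≤ D ^ 2) {z : Fin N → Lp ℝ 2 P}
    (hz : IsPlayerAggregate P W b ξ a z) (i : Fin N) :
    √(∫ ω, (z i ω - c i) ^ 2 ∂P) ≤
      aggregateError cα cz c₀ (√(∫ x, x ^ 2 ∂μ₀)) ζ D r (N * γ) (1 / √N) (frobNorm W) := by
  have hN := natCast_pos_of_fin i
  have hsN : 0 < √(N : ℝ) := Real.sqrt_pos.2 hN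
  set σ := √(∫ x, x ^ 2 ∂μ₀) with hσ
  have hσ2 : σ ^ 2 = ∫ x, x ^ 2 ∂μ₀ := Real.sq_sqrt (integral_nonneg fun x => sq_nonneg x)
  have hσ0 : 0 ≤ σ := Real.sqrt_nonneg _
  have hF0 : 0 ≤ frobNorm W := Real.sqrt_nonneg _
  have hξ : ∀ j, MemLp (ξ j) 2 P := fun j => hμ₀.memLp_two (hlaw j)
  have hmt : ∀ j, MemLp (fun ω => z j ω - c j) 2 P := fun j => (Lp.memLp (z j)).sub (memLp_const _)
  have hmu : ∀ j, MemLp (fun ω => b (a j) (z j ω) - g j) 2 P := fun j =>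
    (memLp_drift_const hb hbb hA (ha j) (z j)).sub (memLp_const _)
  let t : Fin N → ℝ := fun j => ‖(hmt j).toLp‖
  let u : Fin N → ℝ := fun j => ‖(hmu j).toLp‖
  let n : Fin N → ℝ := fun j => ‖(1 / (N : ℝ)) • ∑ k, W j k • (hξ k).toLp‖
  have hn2 : ∀ j, n j ^ 2 = (1 / (N : ℝ) ^ 2) * (∑ k, W j k ^ 2) * σ ^ 2 := fun j => by
    rw [hσ2]; exact norm_noise_sq hμ₀ hlaw hind W j
  -- Subtracting the equation of `c` from that of `z` leaves drift errors, of norms `u`, and pure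
  -- noise, of norm `n`.
  have htn : ∀ j, t j ≤ (1 / (N : ℝ)) * ∑ k, |W j k| * u k + n j := by
    intro j
    have heq : (hmt j).toLp = (1 / (N : ℝ)) • (∑ k, W j k • (hmu k).toLp) +
        (1 / (N : ℝ)) • ∑ k, W j k • (hξ k).toLp := by
      rw [← smul_add, ← Finset.sum_add_distrib]
      simp only [← smul_add]
      rw [Lp.ext_iff]
      have h2 : ∀ᵐ ω ∂P, ∀ k, (hmu k).toLp _ ω = b (a k) (z k ω) - g k ∧
          (hξ k).toLp _ ω = ξ k ω := by
        rw [ae_all_iff]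
        exact fun j => (MemLp.coeFn_toLp _).and (MemLp.coeFn_toLp _)
      filter_upwards [coeFn_smul_sum W (fun k => (hmu k).toLp) (fun k => (hξ k).toLp) j,
        (hmt j).coeFn_toLp, h2, hz j] with ω h3 h4 h5 h6
      rw [h3, h4, h6, hc j, ← mul_sub, ← Finset.sum_sub_distrib]
      simp only [(h5 _).1, (h5 _).2]
      congr 1
      exact Finset.sum_congr rfl fun k _ => by ring
    calc t j = ‖(hmt j).toLp‖ := rfl
      _ ≤ _ := by
          rw [heq]
          exact (norm_add_le _ _).trans (add_le_add_left (norm_smul_sum_le W _ j) _)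
  -- This crude bound suffices for the part of `row_mul_le` that carries the cut distance.
  have huc : ∀ j, u j ≤ 2 * c₀ := by
    intro j
    refine norm_lp_le_of_ae_bound (by linarith [hbb.pos]) ?_
    filter_upwards [(hmu j).coeFn_toLp] with ω h
    rw [h]
    have h1 := hbb.bound _ (ha j) (z j ω)
    exact (abs_sub _ _).trans (by linarith [hg j])
  have hut : ∀ j, u j ≤ √cz * t j + (√cα * |a j - m j| + r) := by
    intro j
    have hs : MemLp (fun _ : Ω => √cα * |a j - m j| + r) 2 P := memLp_const _
    have hs0 : 0 ≤ √cα * |a j - m j| + r := by positivity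
    have hst : MemLp (fun ω => √cz * |z j ω - c j|) 2 P := (hmt j).abs.const_mul _
    have h1 : u j ≤ ‖hst.toLp + hs.toLp‖ := by
      refine Lp.norm_le_norm_of_ae_le ?_
      filter_upwards [(hmu j).coeFn_toLp, Lp.coeFn_add hst.toLp hs.toLp, hst.coeFn_toLp,
        hs.coeFn_toLp] with ω h1 h2 h3 h4
      rw [h1, h2, Pi.add_apply, h3, h4, Real.norm_eq_abs,
        Real.norm_of_nonneg (by positivity)]
      exact hdrift j (z j ω)
    refine h1.trans ((norm_add_le _ _).trans (add_le_add ?_ ?_))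
    · refine Lp.norm_le_mul_norm_of_ae_le_mul ?_
      filter_upwards [hst.coeFn_toLp, (hmt j).coeFn_toLp] with ω h1 h2
      rw [h1, h2, Real.norm_of_nonneg (by positivity), Real.norm_eq_abs]
    · refine norm_lp_le_of_ae_bound hs0 ?_
      filter_upwards [hs.coeFn_toLp] with ω h
      rw [h, abs_of_nonneg hs0]
  have hu0 : ∀ j, 0 ≤ u j := fun j => norm_nonneg _
  have hU := sqrt_sum_sq_le_of_contracting (Real.sqrt_nonneg cz) hcon
    (fun j => norm_nonneg _) hu0 htn hut
  have hnsum : √(∑ j, n j ^ 2) = frobNorm W * σ := by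
    have : ∑ j, n j ^ 2 = (frobNorm W * σ) ^ 2 := by
      simp only [hn2]
      rw [← Finset.sum_mul, ← Finset.mul_sum, ← frobNorm_sq, mul_pow]
    rw [this, Real.sqrt_sq (by positivity)]
  have hssum : √(∑ j, (√cα * |a j - m j| + r) ^ 2) ≤ √cα * D + √N * r := by
    refine (sqrt_sum_sq_le_add (y := fun j => √cα * |a j - m j|) (z := fun _ => r)
      (fun j => by positivity) fun j => le_rfl).trans (add_le_add ?_ ?_)
    · rw [sqrt_sum_const_mul_sq (Real.sqrt_nonneg _)]
      refine mul_le_mul_of_nonneg_left ?_ (Real.sqrt_nonneg _)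
      simp only [sq_abs]
      exact (Real.sqrt_le_sqrt hm).trans_eq (Real.sqrt_sq hD)
    · simp [Real.sqrt_sq hr]
  have hden : 0 < 1 - √cz * frobNorm W := by linarith
  -- Normalising by `1 / √N` keeps the uniform error `r` and shrinks both the noise and the
  -- deviation term `D`.
  have hU2 : (1 / √N) * √(∑ j, u j ^ 2) ≤ (√cz * (frobNorm W * σ) * (1 / √N) +
      √cα * D * (1 / √N) + r) / (1 - √cz * frobNorm W) := by
    rw [le_div_iff₀ hden]
    rw [le_div_iff₀ hden, hnsum] at hU
    have h := mul_le_mul_of_nonneg_left (hU.trans (add_le_add_right hssum _))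
      (by positivity : 0 ≤ 1 / √(N : ℝ))
    have h1 : (1 / √(N : ℝ)) * √N = 1 := one_div_mul_cancel hsN.ne'
    calc _ = 1 / √(N : ℝ) * (√(∑ j, u j ^ 2) * (1 - √cz * frobNorm W)) := by ring
      _ ≤ _ := h
      _ = √cz * (frobNorm W * σ) * (1 / √N) + √cα * D * (1 / √N) + (1 / √(N : ℝ) * √N) * r := by
          ring
      _ = _ := by rw [h1, one_mul]
  have hni : n i ≤ σ * √((2 * (N * γ) + ζ) * (N * γ + ζ * (1 / √N))) := by
    refine abs_le_of_sq_le_sq' ?_ (by positivity) |>.2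
    have h0 : 0 ≤ (2 * (N * γ) + ζ) * (N * γ + ζ * (1 / √N)) := by positivity
    rw [hn2, mul_pow σ, Real.sq_sqrt h0, mul_comm (σ ^ 2)]
    exact mul_le_mul_of_nonneg_right (row_sq_le hw hζ hrow hγ hcut i) (sq_nonneg _)
  have hti : t i = √(∫ ω, (z i ω - c i) ^ 2 ∂P) := by
    rw [← norm_toLp_sq_eq_integral (hmt i), Real.sqrt_sq (norm_nonneg _)]
  rw [← hti]
  have h1 := row_mul_le hw hζ hrow hcut hu0 huc i
  have h2 := mul_le_mul_of_nonneg_left hU2 hζ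
  have h3 := htn i
  unfold aggregateError
  linarith

end PlayerEstimate

/-! ### Near constancy of drift and aggregate on a cell -/

section CellEstimates

variable {A : Set ℝ} {b : ℝ → ℝ → ℝ} {cα cz c₀ : ℝ}

theorem abs_drift_sub_integral_le {X : Type*} [MeasurableSpace X] {ν : Measure X}
    [IsProbabilityMeasure ν] (hA : Convex ℝ A) (hb : DriftLipschitz A b cα cz)
    (hbb : DriftBounded A b c₀) {u z : X → ℝ} (hu : Integrable u ν) (hz : Integrable z ν)
    (huA : ∀ᵐ x ∂ν, u x ∈ A) {a : ℝ} (ha : a ∈ A) (y m c : ℝ) :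
    |b a y - ∫ x, b (u x) (z x) ∂ν| ≤ √cz * |y - c| +
      (√cα * |a - m| + (√cα * (∫ x, |u x - m| ∂ν) + √cz * ∫ x, |z x - c| ∂ν)) := by
  have hg : Integrable (fun x => b (u x) (z x)) ν :=
    (memLp_drift hb hbb hA hu.aemeasurable hz.aemeasurable huA 1).integrable le_rfl
  have hum : Integrable (fun x => |u x - m|) ν := (hu.sub (integrable_const m)).abs
  have hzc : Integrable (fun x => |z x - c|) ν := (hz.sub (integrable_const c)).abs
  have h1 : b a y - ∫ x, b (u x) (z x) ∂ν = ∫ x, (b a y - b (u x) (z x)) ∂ν := by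
    rw [integral_sub (integrable_const _) hg]; simp
  have h2 : ∀ᵐ x ∂ν, |b a y - b (u x) (z x)| ≤
      (√cα * |a - m| + √cz * |y - c|) + (√cα * |u x - m| + √cz * |z x - c|) := by
    filter_upwards [huA] with x hx
    have h3 := hb.abs_sub_le ha hx y (z x)
    have h4 : |a - u x| ≤ |a - m| + |u x - m| := by
      rw [abs_sub_comm (u x) m]; exact abs_sub_le _ _ _
    have h5 : |y - z x| ≤ |y - c| + |z x - c| := by
      rw [abs_sub_comm (z x) c]; exact abs_sub_le _ _ _
    have h6 := mul_le_mul_of_nonneg_left h4 (Real.sqrt_nonneg cα)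
    have h7 := mul_le_mul_of_nonneg_left h5 (Real.sqrt_nonneg cz)
    linarith
  rw [h1]
  refine abs_integral_le_integral_abs.trans ?_
  have hi : Integrable (fun x => √cα * |u x - m| + √cz * |z x - c|) ν :=
    (hum.const_mul (√cα)).add (hzc.const_mul (√cz))
  refine (integral_mono_ae ((integrable_const _).sub hg).abs
    ((integrable_const _).add hi) h2).trans (le_of_eq ?_)
  simp only [Pi.add_apply]
  rw [integral_add (integrable_const _) hi, integral_add (hum.const_mul _) (hzc.const_mul _),
    integral_const_mul, integral_const_mul]
  simp
  ring

/-- On the interval of a player the aggregate is close, in mean, to a constant. -/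
theorem integral_abs_aggregate_sub_le {N : ℕ} (hA : Convex ℝ A) (hb : DriftLipschitz A b cα cz)
    (hbb : DriftBounded A b c₀) {w : I → I → ℝ} (hw : IsGraphon w)
    (hrow : ∀ x, MemLp (w x) 2 volume) (W : Matrix (Fin N) (Fin N) ℝ) {γ : ℝ}
    (hcut : cutDist (stepGraphon W) w ≤ γ) {α z : L2I} (hα : IsAdmissible A α)
    (hz : IsAggregate w b α z) (i : Fin N) :
    ∫ x, |z x - (1 / (N : ℝ)) * ∑ j, W i j * cellAverage N (fun y => b (α y) (z y)) j|
      ∂cellMeasure N i ≤ 4 * c₀ * (N * γ) := by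
  have hN : 1 ≤ N := (Nat.zero_le _).trans_lt i.2
  have hg : MemLp (fun y => b (α y) (z y)) 2 volume :=
    memLp_drift hb hbb hA (Lp.aestronglyMeasurable α).aemeasurable
      (Lp.aestronglyMeasurable z).aemeasurable hα 2
  have hgc : ∀ᵐ y, |b (α y) (z y)| ≤ c₀ := hα.mono fun _ hy => hbb.bound _ hy _
  have h1 := setIntegral_abs_graphonOp_le (k := fun x y => stepGraphon W x y - w x y)
    (integrable_stepGraphon_sub hw W) hg.aestronglyMeasurable hgc (measurableSet_cell i)
  have h2 : 4 * c₀ * cutNorm (fun x y => stepGraphon W x y - w x y) ≤ 4 * c₀ * γ :=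
    mul_le_mul_of_nonneg_left hcut (by linarith [hbb.pos])
  have h3 : ∫ x in cell N i,
      |z x - (1 / (N : ℝ)) * ∑ j, W i j * cellAverage N (fun y => b (α y) (z y)) j| =
      ∫ x in cell N i,
        |graphonOp (fun x y => stepGraphon W x y - w x y) (fun y => b (α y) (z y)) x| := by
    refine setIntegral_congr_ae (measurableSet_cell i) ?_
    filter_upwards [hz] with x hx hxi
    have h4 := integral_sub ((memLp_stepGraphon_row W 2 x).integrable_mul hg)
      ((hrow x).integrable_mul hg)
    simp only [Pi.mul_apply, ← sub_mul] at h4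
    have h5 := graphonOp_stepGraphon W hN (hg.integrable (by norm_num)) hxi
    unfold graphonOp at hx h5 ⊢
    rw [h4, h5, ← hx, abs_sub_comm]
  -- The cut norm bound does not shrink with the cell, so normalising by its length costs the factor
  -- `N`.
  rw [integral_cellMeasure, h3]
  calc _ ≤ (N : ℝ) * (4 * c₀ * γ) := mul_le_mul_of_nonneg_left (h1.trans h2) (by positivity)
    _ = _ := by ring

end CellEstimates

/-! ### The approximate equilibrium and its error -/

section Nash

variable {A : Set ℝ} {b : ℝ → ℝ → ℝ} {f : ℝ → ℝ → ℝ → ℝ} {μ₀ : Measure ℝ}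
  {cα cz c₀ ℓc ℓJ ℓt : ℝ} {N : ℕ}
  {Ω : Type*} [MeasurableSpace Ω] {P : Measure Ω} [IsProbabilityMeasure P]

/-- A bound for the variation of the drift of the equilibrium over the interval of a player. -/
noncomputable def driftError (cα cz c₀ K η δ : ℝ) : ℝ :=
  √cα * ((8 * K * c₀ + 1) * δ) + √cz * (4 * c₀ * η)

/-- The costs before and after a deviation are each within `ℓt` times the aggregate error of `𝒥(·, c
i)`, with the same `c i`. The last term is the defect of the cell mean as a minimizer of `𝒥(·, c
i)`. -/
theorem isEpsNash_cellAverage (hA : Convex ℝ A) (hμ₀ : NoiseLaw μ₀)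
    (hb : DriftLipschitz A b cα cz) (hbb : DriftBounded A b c₀)
    (hJt : CostWassersteinLipschitz A b f μ₀ ℓt) (hJ : CostConvex A b f μ₀ ℓc ℓJ)
    {ξ : Fin N → Ω → ℝ} (hlaw : ∀ i, HasLaw (ξ i) μ₀ P) (hind : iIndepFun ξ P)
    {w : I → I → ℝ} (hw : IsGraphon w) {ζ γ : ℝ} (hζ : 0 ≤ ζ)
    (hmem : ∀ x, MemLp (w x) 2 volume)
    (hrow : ∀ x, ∫ y, w x y ^ 2 ≤ ζ ^ 2) {W : Matrix (Fin N) (Fin N) ℝ} (hγ : 0 ≤ γ)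
    (hcut : cutDist (stepGraphon W) w ≤ γ) (hcon : √cz * frobNorm W < 1)
    {D δ : ℝ} (hD : 0 ≤ D) (hAD : ∀ x ∈ A, ∀ y ∈ A, |x - y| ≤ D)
    (hδ : 0 < δ) (hηδ : N * γ ≤ δ ^ 2)
    {α z : L2I} (hα : IsAdmissible A α) (hz : IsAggregate w b α z)
    (hmin : ∀ᵐ x : I, ∀ β ∈ A, costJ b f μ₀ (α x) (z x) ≤ costJ b f μ₀ β (z x)) :
    IsEpsNash P A W b f ξ
      (2 * ℓt * aggregateError cα cz c₀ (√(∫ x, x ^ 2 ∂μ₀)) ζ D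
        (driftError cα cz c₀ (4 * ℓt / ℓc) (N * γ) δ) (N * γ) (1 / √N) (frobNorm W) +
        2 * ℓt * (4 * c₀ * (N * γ)))
      (cellAverage N α) := by
  have hK : 0 ≤ 4 * ℓt / ℓc := div_nonneg (mul_nonneg (by norm_num) hJt.nonneg) hJ.ℓc_pos.le
  have hc₀ := hbb.pos
  set r := driftError cα cz c₀ (4 * ℓt / ℓc) (N * γ) δ with hrdef
  have hr : 0 ≤ r := by rw [hrdef, driftError]; positivity
  set E := aggregateError cα cz c₀ (√(∫ x, x ^ 2 ∂μ₀)) ζ D r (N * γ) (1 / √N) (frobNorm W)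
    with hE
  let g : Fin N → ℝ := cellAverage N fun y => b (α y) (z y)
  let c : Fin N → ℝ := fun i => (1 / (N : ℝ)) * ∑ j, W i j * g j
  have hαi : ∀ i, Integrable α (cellMeasure N i) := fun i =>
    integrable_cellMeasure ((Lp.memLp α).integrable (by norm_num)) i
  have hzi : ∀ i, Integrable z (cellMeasure N i) := fun i =>
    integrable_cellMeasure ((Lp.memLp z).integrable (by norm_num)) i
  have hαc : ∀ i, ∀ᵐ x ∂cellMeasure N i, α x ∈ A := fun i =>
    (cellMeasure_absolutelyContinuous i).ae_le hα
  have hminc : ∀ i, ∀ᵐ x ∂cellMeasure N i, ∀ β ∈ A,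
      costJ b f μ₀ (α x) (z x) ≤ costJ b f μ₀ β (z x) := fun i =>
    (cellMeasure_absolutelyContinuous i).ae_le hmin
  have havg : ∀ (h : I → ℝ) i, cellAverage N h i = ∫ x, h x ∂cellMeasure N i := fun h i =>
    (integral_cellMeasure h i).symm
  have he : ∀ i, ∫ x, |z x - c i| ∂cellMeasure N i ≤ 4 * c₀ * (N * γ) := fun i =>
    integral_abs_aggregate_sub_le hA hb hbb hw hmem W hcut hα hz i
  have hdev : ∀ i, ∫ x, |α x - cellAverage N α i| ∂cellMeasure N i ≤
      (8 * (4 * ℓt / ℓc) * c₀ + 1) * δ := by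
    intro i
    have h := integral_abs_sub_integral_le hJt hJ hμ₀ (hαi i) (hzi i) (hαc i) (hminc i) (c i) hδ
    rw [← havg α] at h
    refine h.trans ?_
    -- The condition `N * γ ≤ δ ^ 2` absorbs the division by `δ` in the Hölder estimate.
    have h1 : 2 * (4 * ℓt / ℓc) * (∫ x, |z x - c i| ∂cellMeasure N i) ≤
        2 * (4 * ℓt / ℓc) * (4 * c₀ * δ ^ 2) := by
      refine mul_le_mul_of_nonneg_left ((he i).trans ?_) (by positivity)
      exact mul_le_mul_of_nonneg_left hηδ (by positivity)
    have h2 : 2 * (4 * ℓt / ℓc) * (∫ x, |z x - c i| ∂cellMeasure N i) / δ ≤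
        8 * (4 * ℓt / ℓc) * c₀ * δ := by
      rw [div_le_iff₀ hδ]
      exact h1.trans (le_of_eq (by ring))
    linarith
  have hmA : ∀ i, cellAverage N α i ∈ A := fun i => by
    rw [havg]; exact integral_mem_of_convex hA (hαi i) (hαc i)
  have hg : ∀ i, |g i| ≤ c₀ := by
    intro i
    have h1 : |g i| ≤ ∫ _, c₀ ∂cellMeasure N i := by
      change |cellAverage N _ i| ≤ _
      rw [havg]
      refine abs_integral_le_integral_abs.trans (integral_mono_ae ?_ (integrable_const _) ?_)
      · exact ((memLp_drift hb hbb hA (hαi i).aemeasurable (hzi i).aemeasurable (hαc i)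
          1).integrable le_rfl).abs
      · exact (hαc i).mono fun _ hx => hbb.bound _ hx _
    simpa using h1
  have hdrift : ∀ a : Fin N → ℝ, (∀ i, a i ∈ A) → ∀ j y,
      |b (a j) y - g j| ≤ √cz * |y - c j| + (√cα * |a j - cellAverage N α j| + r) := by
    intro a ha j y
    have h := abs_drift_sub_integral_le hA hb hbb (hαi j) (hzi j) (hαc j) (ha j) y
      (cellAverage N α j) (c j)
    rw [← havg] at h
    refine h.trans ?_
    have h1 := mul_le_mul_of_nonneg_left (hdev j) (Real.sqrt_nonneg cα)
    have h2 := mul_le_mul_of_nonneg_left (he j) (Real.sqrt_nonneg cz)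
    rw [hrdef, driftError]
    linarith
  have hcost : ∀ a : Fin N → ℝ, (∀ i, a i ∈ A) →
      ∑ j, (a j - cellAverage N α j) ^ 2 ≤ D ^ 2 → ∀ i,
      |costJ b f μ₀ (a i) (c i) - playerCost P W b f ξ a i| ≤ ℓt * E := by
    intro a ha haD i
    have hZ : IsPlayerAggregate P W b ξ a (playerAggregate P W b ξ a) :=
      Classical.epsilon_spec (playerAggregateWellDefined hb hbb hA W
        (fun j => hμ₀.memLp_two (hlaw j)) hcon a ha).exists
    have h1 := sqrt_integral_playerAggregate_le hA hμ₀ hb hbb hlaw hind hw hζ hrow hγ hcut hcon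
      hr hD ha hg (fun _ => rfl) (hdrift a ha) haD hZ i
    have h2 := hJt.abs_sub_le hμ₀ (ha i) (hlaw i) (Lp.memLp (playerAggregate P W b ξ a i))
      (memLp_const (c i))
    rw [hJt.costJTilde_map_const hμ₀ (ha i) (hlaw i)] at h2
    exact h2.trans (mul_le_mul_of_nonneg_left h1 hJt.nonneg)
  refine ⟨hmA, fun i β hβ => ?_⟩
  have hup : ∀ j, Function.update (cellAverage N α) i β j ∈ A := by
    intro j
    rcases eq_or_ne j i with rfl | hji
    · simpa using hβ
    · simpa [hji] using hmA j
  have h1 := hcost _ hmA (by simpa using sq_nonneg D) i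
  -- Only coordinate `i` differs from the averages, and by at most the diameter bound `D`.
  have h2 := hcost _ hup (by
    rw [Finset.sum_eq_single i]
    · have h := hAD _ hβ _ (hmA i)
      simpa using sq_le_sq' (neg_le_of_abs_le h) (le_of_abs_le h)
    · intro j _ hj
      simp [hj]
    · simp) i
  rw [Function.update_self] at h2
  have h3 := costJ_integral_le hA hJt hJ hμ₀ (hαi i) (hzi i) (hαc i) (hminc i) hβ (c i)
  rw [← havg] at h3
  have h4 := mul_le_mul_of_nonneg_left (he i) (by linarith [hJt.nonneg] : 0 ≤ 2 * ℓt)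
  have h5 := (abs_le.1 h1).1
  have h6 := (abs_le.1 h2).2
  linarith

theorem tendsto_nashError (K D ζ σ l : ℝ) (hl : √cz * l < 1) {η s d F : ℕ → ℝ}
    (hη : Tendsto η atTop (𝓝 0)) (hs : Tendsto s atTop (𝓝 0)) (hd : Tendsto d atTop (𝓝 0))
    (hF : Tendsto F atTop (𝓝 l)) :
    Tendsto (fun N => 2 * ℓt * aggregateError cα cz c₀ σ ζ D
      (driftError cα cz c₀ K (η N) (√(η N) + d N)) (η N) (s N) (F N) +
      2 * ℓt * (4 * c₀ * η N)) atTop (𝓝 0) := by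
  have hr : Tendsto (fun N => driftError cα cz c₀ K (η N) (√(η N) + d N)) atTop (𝓝 0) := by
    have h := ((((hη.sqrt.add hd).const_mul (8 * K * c₀ + 1)).const_mul (√cα)).add
      ((hη.const_mul (4 * c₀)).const_mul (√cz)))
    simpa [driftError] using h
  have hne : 1 - √cz * l ≠ 0 := by linarith
  have h1 := ((((hF.mul_const σ).const_mul (√cz)).mul hs).add (hs.const_mul (√cα * D))).add hr
  have h2 := (h1.div (tendsto_const_nhds.sub (hF.const_mul (√cz))) hne).const_mul ζ
  have h3 := ((((hη.const_mul 2).add_const ζ).mul (hη.add (hs.const_mul ζ))).sqrt).const_mul σ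
  have h4 := ((((hη.const_mul (4 * c₀)).add h2).add h3).const_mul (2 * ℓt)).add
    ((hη.const_mul (4 * c₀)).const_mul (2 * ℓt))
  simpa [aggregateError] using h4

end Nash

end GraphonGame

/-! ### The main theorem -/

theorem mainTheorem3
    (A : Set ℝ) (hA_convex : Convex ℝ A) (hA_bounded : Bornology.IsBounded A)
    (b : ℝ → ℝ → ℝ) (f : ℝ → ℝ → ℝ → ℝ) (μ₀ : Measure ℝ)
    (cα cz c₀ ℓc ℓJ ℓt ζ ζt : ℝ)
    (hμ₀ : NoiseLaw μ₀)
    (hb_lip : DriftLipschitz A b cα cz)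
    (hb_bdd : DriftBounded A b c₀)
    (hJt : CostWassersteinLipschitz A b f μ₀ ℓt)
    (hJ : CostConvex A b f μ₀ ℓc ℓJ)
    -- the `N`-player noises
    {Ω : ℕ → Type*} [∀ N, MeasurableSpace (Ω N)]
    (P : ∀ N, Measure (Ω N)) [∀ N, IsProbabilityMeasure (P N)]
    (ξ : ∀ N, Fin N → Ω N → ℝ)
    (hξ_law : ∀ N i, HasLaw (ξ N i) μ₀ (P N))
    (hξ_indep : ∀ N, iIndepFun (ξ N) (P N))
    -- the interaction matrices
    (W : ∀ N, Matrix (Fin N) (Fin N) ℝ)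
    (hW_symm : ∀ N, (W N).IsSymm)
    (hW_row : ∀ N : ℕ, 1 ≤ N → ∀ i, (1 / (N : ℝ) ^ 2) * ∑ j, W N i j ^ 2 ≤ ζt)
    -- the limit graphon
    (w : I → I → ℝ) (hw : IsGraphon w)
    (hw_l2 : Real.sqrt (2 * cz) * l2Norm w < 1)
    (hw_op : Real.sqrt cz * opNorm w < 1)
    (hw_row : ∀ x, eLpNorm (w x) 2 volume ≤ ENNReal.ofReal ζ)
    (h_l2 : Tendsto (fun N => l2Norm (stepGraphon (W N))) atTop (𝓝 (l2Norm w)))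
    (h_op : Tendsto (fun N => opNorm (stepGraphon (W N))) atTop (𝓝 (opNorm w)))
    (γ : ℕ → ℝ) (h_cut : ∀ N : ℕ, 1 ≤ N → cutDist (stepGraphon (W N)) w ≤ γ N)
    (hγ : Tendsto (fun N : ℕ => (N : ℝ) * γ N) atTop (𝓝 0))
    -- a Nash equilibrium of the graphon game
    (α : L2I) (hα : IsGraphonNash A b f μ₀ w α) :
    ∃ ε : ℕ → ℝ, Tendsto ε atTop (𝓝 0) ∧
      (∀ᶠ N in atTop, Real.sqrt cz * frobNorm (W N) < 1) ∧
      ∀ N : ℕ, 1 ≤ N → Real.sqrt cz * frobNorm (W N) < 1 →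
        PlayerAggregateWellDefined (P N) A (W N) b (ξ N) ∧
        IsEpsNash (P N) A (W N) b f (ξ N) (ε N) (cellAverage N α) := by
  have hl : √cz * l2Norm w < 1 := by
    refine lt_of_le_of_lt (mul_le_mul_of_nonneg_right ?_ (Real.sqrt_nonneg _)) hw_l2
    exact Real.sqrt_le_sqrt (by linarith [hb_lip.cz_nonneg])
  have hF : Tendsto (fun N => frobNorm (W N)) atTop (𝓝 (l2Norm w)) := by
    refine h_l2.congr' ?_
    filter_upwards [eventually_ge_atTop 1] with N hN
    exact l2Norm_stepGraphon (W N) hN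
  have hmem : ∀ x, MemLp (w x) 2 volume := fun x =>
    ⟨(hw.measurable.comp measurable_prodMk_left).aestronglyMeasurable,
      (hw_row x).trans_lt ENNReal.ofReal_lt_top⟩
  -- `ENNReal.ofReal` truncates a negative `ζ` to zero, hence the maximum.
  have hrow : ∀ x, ∫ y, w x y ^ 2 ≤ (max ζ 0) ^ 2 := by
    intro x
    rw [integral_sq_eq_eLpNorm_sq (hmem x)]
    refine pow_le_pow_left₀ ENNReal.toReal_nonneg ?_ 2
    have h := ENNReal.toReal_mono ENNReal.ofReal_ne_top (hw_row x)
    rwa [ENNReal.toReal_ofReal'] at h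
  obtain ⟨D, hAD⟩ := Metric.isBounded_iff.1 hA_bounded
  -- The aggregate is a Hilbert choice, so it solves its equation only once a solution is known to
  -- exist.
  have hz : IsAggregate w b α (aggregate w b α) :=
    Classical.epsilon_spec (exists_isAggregate hA_convex hb_lip hb_bdd hw hmem hl hα.1)
  have hγ0 : ∀ N, 1 ≤ N → 0 ≤ γ N := fun N hN =>
    (cutNorm_nonneg (k := fun x y => stepGraphon (W N) x y - w x y)
      (integrable_stepGraphon_sub hw (W N))).trans (h_cut N hN)
  have hs : Tendsto (fun N : ℕ => 1 / √(N : ℝ)) atTop (𝓝 0) :=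
    tendsto_const_nhds.div_atTop (Real.tendsto_sqrt_atTop.comp tendsto_natCast_atTop_atTop)
  -- The scale is `δ = √(N γ_N) + 1 / N`: the root gives `N γ_N ≤ δ ^ 2`, and `1 / N` keeps `δ`
  -- positive when `γ_N = 0`.
  refine ⟨_, tendsto_nashError (cα := cα) (cz := cz) (c₀ := c₀) (ℓt := ℓt) (4 * ℓt / ℓc)
    (max D 0) (max ζ 0) (√(∫ x, x ^ 2 ∂μ₀)) (l2Norm w) hl hγ hs
    tendsto_one_div_atTop_nhds_zero_nat hF, ?_, ?_⟩
  · exact (hF.const_mul (√cz)).eventually_lt_const hl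
  · intro N hN hcon
    have hN0 : (0 : ℝ) < N := by exact_mod_cast hN
    have hη : 0 ≤ N * γ N := mul_nonneg hN0.le (hγ0 N hN)
    refine ⟨playerAggregateWellDefined hb_lip hb_bdd hA_convex (W N)
      (fun i => hμ₀.memLp_two (hξ_law N i)) hcon, ?_⟩
    refine isEpsNash_cellAverage hA_convex hμ₀ hb_lip hb_bdd hJt hJ (hξ_law N) (hξ_indep N) hw
      (le_max_right _ _) hmem hrow (hγ0 N hN) (h_cut N hN) hcon (le_max_right _ _)
      (fun x hx y hy => (hAD hx hy).trans (le_max_left _ _)) (by positivity) ?_ hα.1 hz hα.2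
    calc N * γ N = √(N * γ N) ^ 2 := (Real.sq_sqrt hη).symm
      _ ≤ _ := pow_le_pow_left₀ (Real.sqrt_nonneg _) (le_add_of_nonneg_right (by positivity)) 2
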